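/- Let $k\ge 1$. A *$k$-graph* is a countable category $\Lambda$ with a functor $d:\Lambda\to\mathbb N^k$ (the degree) such that whenever $d(\lambda)=m+n$ there are unique $\mu,\nu\in\Lambda$ with $d(\mu)=m$, $d(\nu)=n$ and $\lambda=\mu\nu$. Write $r$ and $s$ for the codomain and domain maps, $\Lambda^0$ for the set of objects (vertices, identified with the morphisms of degree $0$), $v\Lambda=\{\lambda: r(\lambda)=v\}$ and $v\Lambda^n=\{\lambda\in v\Lambda: d(\lambda)=n\}$. Let $\Lambda$ be row-finite without sources, i.e. every $v\Lambda^n$ is finite and nonempty, and let $R$ be a commutative ring with $1\neq 0$. The *Kumjian–Pask algebra* $\mathrm{KP}_R(\Lambda)$ is the (not necessarily unital) $R$-algebra generated by elements $p_v$ ($v\in\Lambda^0$) and $s_\lambda,s_{\lambda^*}$ ($\lambda\in\Lambda$, $d(\lambda)\ne0$) subject to: the $p_v$ are mutually orthogonal idempotents; $s_\lambda s_\mu=s_{\lambda\mu}$ and $s_{\mu^*}s_{\lambda^*}=s_{(\lambda\mu)^*}$ when $s(\lambda)=r(\mu)$; $p_{r(\lambda)}s_\lambda=s_\lambda=s_\lambda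 p_{s(\lambda)}$ and $p_{s(\lambda)}s_{\lambda^*}=s_{\lambda^*}=s_{\lambda^*}p_{r(\lambda)}$; $s_{\lambda^*}s_\mu=\delta_{\lambda,\mu}p_{s(\lambda)}$ when $d(\lambda)=d(\mu)$; and $p_v=\sum_{\lambda\in v\Lambda^n}s_\lambda s_{\lambda^*}$ for $n\neq0$. With $s_v=s_{v^*}=p_v$ for $v\in\Lambda^0$, it is $\mathbb Z^k$-graded by $\mathrm{KP}_R(\Lambda)_n=\operatorname{span}_R\{s_\lambda s_{\mu^*}: d(\lambda)-d(\mu)=n\}$. An ideal $I$ of $\mathrm{KP}_R(\Lambda)$ (always two-sided) is *graded* if $\{I\cap \mathrm{KP}_R(\Lambda)_n\}_{n\in\mathbb Z^k}$ is a grading of $I$, and *basic* if $rp_v\in I$ with $r\in R\setminus\{0\}$, $v\in\Lambda^0$ implies $p_v\in I$. A set $H\subset\Lambda^0$ is *hereditary* if $r(\lambda)\in H$ implies $s(\lambda)\in H$, and *saturated* if $s(v\Lambda^n)\subset H$ for some $n\in\mathbb N^k$ implies $v\in H$. For saturated hereditary $H$, let $I_H$ be the ideal generated by $\{p_v:v\in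 H\}$ and let $\Lambda\setminus H$ be the $k$-graph with vertex set $\Lambda^0\setminus H$ and morphisms $\{\lambda\in\Lambda: s(\lambda)\notin H\}$. A $k$-graph $\Gamma$ is *aperiodic* if for every $v\in\Gamma^0$ and $m\ne n$ in $\mathbb N^k$ there is $\lambda\in v\Gamma$ with $d(\lambda)\ge m\vee n$ and $\lambda(m,m+d(\lambda)-(m\vee n))\neq\lambda(n,n+d(\lambda)-(m\vee n))$, where, for $p\le q\le d(\lambda)$, $\lambda(p,q)$ is the unique $\lambda''$ with $\lambda=\lambda'\lambda''\lambda'''$, $d(\lambda')=p$, $d(\lambda'')=q-p$. **Theorem.** Every basic ideal of $\mathrm{KP}_R(\Lambda)$ is graded if and only if $\Lambda\setminus H$ is aperiodic for every saturated hereditary subset $H$ of $\Lambda^0$. In that case $H\mapsto I_H$ is an isomorphism from the lattice of saturated hereditary subsets of $\Lambda^0$ onto the lattice of basic ideals of $\mathrm{KP}_R(\Lambda)$ (both ordered by inclusion). -/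

import Mathlib

/-! ## Higher-rank graphs -/

universe u v w

/-- A graph of rank `k`: a countable category, presented by its objects (vertices), its morphisms
(paths), its codomain map `rng`, domain map `src`, identities and the partial composition
`comp μ ν` (first `ν`, then `μ`, defined when `src μ = rng ν`), with a degree functor to `ℕᵏ`
that has the factorization property. -/
structure KGraph (k : ℕ) where
  Vert : Type u
  Path : Type v
  rng : Path → Vert
  src : Path → Vert
  id : Vert → Path
  comp : ∀ μ ν : Path, src μ = rng ν → Path
  rng_id : ∀ x, rng (id x) = x
  src_id : ∀ x, src (id x) = x
  rng_comp : ∀ μ ν h, rng (comp μ ν h) = rng μ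
  src_comp : ∀ μ ν h, src (comp μ ν h) = src ν
  id_comp : ∀ μ, comp (id (rng μ)) μ (src_id _) = μ
  comp_id : ∀ μ, comp μ (id (src μ)) (rng_id _).symm = μ
  assoc : ∀ (μ ν τ : Path) (h₁ : src μ = rng ν) (h₂ : src ν = rng τ),
    comp (comp μ ν h₁) τ ((src_comp _ _ _).trans h₂) =
      comp μ (comp ν τ h₂) (h₁.trans (rng_comp _ _ _).symm)
  countable_path : Countable Path
  deg : Path → (Fin k → ℕ)
  deg_id : ∀ x, deg (id x) = 0
  deg_comp : ∀ μ ν h, deg (comp μ ν h) = deg μ + deg ν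
  factorization : ∀ (l : Path) (m n : Fin k → ℕ), deg l = m + n →
    ∃! q : Path × Path, deg q.1 = m ∧ deg q.2 = n ∧ ∃ h : src q.1 = rng q.2, comp q.1 q.2 h = l

namespace KGraph

variable {k : ℕ} (Λ : KGraph.{u, v} k)

/-- For every vertex `x` and every `n`, the set `xΛⁿ` is finite. -/
def RowFinite : Prop :=
  ∀ (x : Λ.Vert) (n : Fin k → ℕ), {l : Λ.Path | Λ.rng l = x ∧ Λ.deg l = n}.Finite

/-- For every vertex `x` and every `n`, the set `xΛⁿ` is nonempty. -/
def NoSources : Prop :=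
  ∀ (x : Λ.Vert) (n : Fin k → ℕ), {l : Λ.Path | Λ.rng l = x ∧ Λ.deg l = n}.Nonempty

/-- `μ` is the segment `l(p, q)` of `l`, that is, `l = α μ β` with `deg α = p` and
`deg μ = q - p`. For `p ≤ q ≤ deg l` there is exactly one such `μ`. -/
def IsSegment (l : Λ.Path) (p q : Fin k → ℕ) (μ : Λ.Path) : Prop :=
  ∃ (α β : Λ.Path) (h₁ : Λ.src α = Λ.rng μ) (h₂ : Λ.src (Λ.comp α μ h₁) = Λ.rng β),
    Λ.deg α = p ∧ p + Λ.deg μ = q ∧ Λ.comp (Λ.comp α μ h₁) β h₂ = l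

/-- The finite-path formulation of aperiodicity: for all vertices `x` and all `m ≠ n` there is
`l ∈ xΛ` with `deg l ≥ m ⊔ n` and
`l(m, m + deg l - (m ⊔ n)) ≠ l(n, n + deg l - (m ⊔ n))`. -/
def Aperiodic : Prop :=
  ∀ (x : Λ.Vert) (m n : Fin k → ℕ), m ≠ n →
    ∃ l : Λ.Path, Λ.rng l = x ∧ m ⊔ n ≤ Λ.deg l ∧
      ∃ μ ν : Λ.Path, Λ.IsSegment l m (m + (Λ.deg l - (m ⊔ n))) μ ∧
        Λ.IsSegment l n (n + (Λ.deg l - (m ⊔ n))) ν ∧ μ ≠ ν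

/-- Hereditary sets of vertices. -/
def Hereditary (H : Set Λ.Vert) : Prop :=
  ∀ l : Λ.Path, Λ.rng l ∈ H → Λ.src l ∈ H

/-- Saturated sets of vertices. -/
def Saturated (H : Set Λ.Vert) : Prop :=
  ∀ (x : Λ.Vert) (n : Fin k → ℕ), (∀ l : Λ.Path, Λ.rng l = x → Λ.deg l = n → Λ.src l ∈ H) → x ∈ H

/-- The saturated hereditary subsets of the vertex set. -/
@[ext]
structure SatHer where
  carrier : Set Λ.Vert
  hereditary : Λ.Hereditary carrier
  saturated : Λ.Saturated carrier

variable {Λ}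

namespace SatHer

/-- Saturated hereditary sets are ordered by inclusion. -/
instance : PartialOrder Λ.SatHer :=
  PartialOrder.lift SatHer.carrier (fun _ _ h => SatHer.ext h)

instance : InfSet Λ.SatHer where
  sInf S :=
    { carrier := {x | ∀ H ∈ S, x ∈ H.carrier}
      hereditary := fun l hl H hH => H.hereditary l (hl H hH)
      saturated := fun x n h H hH => H.saturated x n fun l h₁ h₂ => h l h₁ h₂ H hH }

/-- The lattice of saturated hereditary sets; meets are intersections, and the join of a family is
the smallest saturated hereditary set containing all its members. -/
instance : CompleteLattice Λ.SatHer :=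
  completeLatticeOfInf Λ.SatHer fun _ =>
    ⟨fun H hH _ hx => hx H hH, fun _ hK _ hx _ hH => hK hH hx⟩

end SatHer

variable (Λ)

/-- The `k`-graph `Λ ∖ H` for a hereditary set `H`: its vertices are those outside `H`, its paths
are the paths of `Λ` with source outside `H`, and the structure maps are those of `Λ`. -/
def removeHereditary (H : Set Λ.Vert) (hH : Λ.Hereditary H) : KGraph.{u, v} k where
  Vert := {x : Λ.Vert // x ∉ H}
  Path := {l : Λ.Path // Λ.src l ∉ H}
  rng l := ⟨Λ.rng l.1, fun h => l.2 (hH l.1 h)⟩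
  src l := ⟨Λ.src l.1, l.2⟩
  id x := ⟨Λ.id x.1, by rw [Λ.src_id]; exact x.2⟩
  comp μ ν h := ⟨Λ.comp μ.1 ν.1 (congrArg Subtype.val h), by rw [Λ.src_comp]; exact ν.2⟩
  rng_id x := Subtype.ext (Λ.rng_id x.1)
  src_id x := Subtype.ext (Λ.src_id x.1)
  rng_comp μ ν h := Subtype.ext (Λ.rng_comp μ.1 ν.1 _)
  src_comp μ ν h := Subtype.ext (Λ.src_comp μ.1 ν.1 _)
  id_comp μ := Subtype.ext (Λ.id_comp μ.1)
  comp_id μ := Subtype.ext (Λ.comp_id μ.1)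
  assoc μ ν τ h₁ h₂ := Subtype.ext (Λ.assoc μ.1 ν.1 τ.1 _ _)
  countable_path := by
    have := Λ.countable_path
    infer_instance
  deg l := Λ.deg l.1
  deg_id x := Λ.deg_id x.1
  deg_comp μ ν h := Λ.deg_comp μ.1 ν.1 _
  factorization l m n hl := by
    obtain ⟨⟨μ, ν⟩, ⟨h1, h2, h3, h4⟩, huniq⟩ := Λ.factorization l.1 m n hl
    dsimp only at h1 h2 h3 h4
    have hν : Λ.src ν ∉ H := by rw [← Λ.src_comp μ ν h3, h4]; exact l.2
    have hμ : Λ.src μ ∉ H := fun h => hν (hH ν (h3 ▸ h))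
    refine ⟨(⟨μ, hμ⟩, ⟨ν, hν⟩), ⟨h1, h2, Subtype.ext h3, Subtype.ext h4⟩, ?_⟩
    rintro ⟨⟨μ', hμ'⟩, ⟨ν', hν'⟩⟩ ⟨g1, g2, g3, g4⟩
    have := huniq (μ', ν') ⟨g1, g2, congrArg Subtype.val g3, congrArg Subtype.val g4⟩
    obtain ⟨rfl, rfl⟩ := Prod.mk.inj this
    rfl

/-- The `k`-graph `Λ ∖ H` for a saturated hereditary set `H`. -/
abbrev remove (H : Λ.SatHer) : KGraph.{u, v} k :=
  Λ.removeHereditary H.carrier H.hereditary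

/-! ## The Kumjian–Pask algebra -/

/-- The paths of nonzero degree. -/
abbrev PosPath : Type v := {l : Λ.Path // Λ.deg l ≠ 0}

/-- The alphabet: vertices, paths of nonzero degree, and ghost paths of nonzero degree. -/
inductive Gen : Type (max u v)
  | vert (x : Λ.Vert) : Gen
  | path (l : Λ.PosPath) : Gen
  | ghost (l : Λ.PosPath) : Gen

end KGraph

variable {k : ℕ} (R : Type w) [CommRing R] (Λ : KGraph.{u, v} k)

/-- The free (non-unital) `R`-algebra on the alphabet: formal `R`-linear combinations of nonempty
words, multiplied by concatenation. -/
abbrev KPFree : Type _ := MonoidAlgebra R (FreeSemigroup Λ.Gen)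

namespace KPFree

variable {Λ}

/-- A letter of the alphabet as an element of the free algebra. -/
noncomputable def letter (g : Λ.Gen) : KPFree R Λ :=
  MonoidAlgebra.single (FreeSemigroup.of g) 1

/-- The vertex `x` in the free algebra. -/
noncomputable abbrev vert (x : Λ.Vert) : KPFree R Λ := letter R (.vert x)

/-- The path `l` in the free algebra. -/
noncomputable abbrev path (l : Λ.PosPath) : KPFree R Λ := letter R (.path l)

/-- The ghost path `l*` in the free algebra. -/
noncomputable abbrev ghost (l : Λ.PosPath) : KPFree R Λ := letter R (.ghost l)

/-- The Kumjian–Pask relators. The last one is imposed for every finite enumeration `t` of `xΛⁿ`,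
hence for all `x` and all `n ≠ 0` when `Λ` is row-finite. -/
inductive Relator : KPFree R Λ → Prop
  | vert_idem (x : Λ.Vert) : Relator (vert R x * vert R x - vert R x)
  | vert_orth (x y : Λ.Vert) (h : x ≠ y) : Relator (vert R x * vert R y)
  | path_comp (l μ ν : Λ.PosPath) (h : Λ.src μ.1 = Λ.rng ν.1) (hl : l.1 = Λ.comp μ.1 ν.1 h) :
      Relator (path R l - path R μ * path R ν)
  | ghost_comp (l μ ν : Λ.PosPath) (h : Λ.src μ.1 = Λ.rng ν.1) (hl : l.1 = Λ.comp μ.1 ν.1 h) :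
      Relator (ghost R l - ghost R ν * ghost R μ)
  | rng_path (l : Λ.PosPath) : Relator (vert R (Λ.rng l.1) * path R l - path R l)
  | path_src (l : Λ.PosPath) : Relator (path R l - path R l * vert R (Λ.src l.1))
  | src_ghost (l : Λ.PosPath) : Relator (vert R (Λ.src l.1) * ghost R l - ghost R l)
  | ghost_rng (l : Λ.PosPath) : Relator (ghost R l - ghost R l * vert R (Λ.rng l.1))
  | ghost_path_self (l : Λ.PosPath) : Relator (ghost R l * path R l - vert R (Λ.src l.1))
  | ghost_path_ne (l μ : Λ.PosPath) (hd : Λ.deg l.1 = Λ.deg μ.1) (h : l ≠ μ) :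
      Relator (ghost R l * path R μ)
  | sum_path_ghost (x : Λ.Vert) (n : Fin k → ℕ) (hn : n ≠ 0) (t : Finset Λ.PosPath)
      (ht : ∀ l : Λ.PosPath, l ∈ t ↔ Λ.rng l.1 = x ∧ Λ.deg l.1 = n) :
      Relator (vert R x - ∑ l ∈ t, path R l * ghost R l)

variable (Λ)

/-- The ideal of the `R`-algebra `KPFree R Λ` generated by the relators: the smallest two-sided
ideal that contains them and is closed under multiplication by scalars. -/
noncomputable def relIdeal : TwoSidedIdeal (KPFree R Λ) :=
  sInf {I | (∀ a, Relator R a → a ∈ I) ∧ ∀ (r : R) (a : KPFree R Λ), a ∈ I → r • a ∈ I}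

theorem smul_mem_relIdeal (r : R) {a : KPFree R Λ} (ha : a ∈ relIdeal R Λ) :
    r • a ∈ relIdeal R Λ := by
  rw [relIdeal, TwoSidedIdeal.mem_sInf] at ha ⊢
  exact fun I hI => hI.2 r a (ha I hI)

end KPFree

/-- The Kumjian–Pask algebra `KP_R(Λ)`. -/
def KP : Type _ := (KPFree.relIdeal R Λ).ringCon.Quotient

namespace KP

noncomputable instance : NonUnitalRing (KP R Λ) :=
  inferInstanceAs (NonUnitalRing (KPFree.relIdeal R Λ).ringCon.Quotient)

variable {Λ}

/-- The quotient map from the free algebra. -/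
noncomputable def mk (a : KPFree R Λ) : KP R Λ := (a : (KPFree.relIdeal R Λ).ringCon.Quotient)

theorem mk_surjective : Function.Surjective (mk R (Λ := Λ)) :=
  fun q => Quotient.inductionOn' q fun a => ⟨a, rfl⟩

theorem mk_eq_iff {a b : KPFree R Λ} : mk R a = mk R b ↔ a - b ∈ KPFree.relIdeal R Λ := by
  rw [← TwoSidedIdeal.rel_iff]
  exact RingCon.eq _

theorem mk_add (a b : KPFree R Λ) : mk R (a + b) = mk R a + mk R b := rfl

theorem mk_mul (a b : KPFree R Λ) : mk R (a * b) = mk R a * mk R b := rfl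

noncomputable instance : SMul R (KP R Λ) where
  smul r := Quotient.map' (r • ·) fun a b h => by
    have h' : a - b ∈ KPFree.relIdeal R Λ := (TwoSidedIdeal.rel_iff _ _ _).1 h
    refine (TwoSidedIdeal.rel_iff (KPFree.relIdeal R Λ) _ _).2 ?_
    have := KPFree.smul_mem_relIdeal R Λ r h'
    rwa [smul_sub] at this

theorem mk_smul (r : R) (a : KPFree R Λ) : mk R (r • a) = r • mk R a := rfl

noncomputable instance : Module R (KP R Λ) :=
  Function.Surjective.module R
    (⟨⟨mk R, rfl⟩, mk_add R⟩ : KPFree R Λ →+ KP R Λ) (mk_surjective R) (mk_smul R)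

instance : IsScalarTower R (KP R Λ) (KP R Λ) where
  smul_assoc r x y := by
    obtain ⟨a, rfl⟩ := mk_surjective R x
    obtain ⟨b, rfl⟩ := mk_surjective R y
    simp only [smul_eq_mul, ← mk_smul, ← mk_mul, smul_mul_assoc]

instance : SMulCommClass R (KP R Λ) (KP R Λ) where
  smul_comm r x y := by
    obtain ⟨a, rfl⟩ := mk_surjective R x
    obtain ⟨b, rfl⟩ := mk_surjective R y
    simp only [smul_eq_mul, ← mk_smul, ← mk_mul, mul_smul_comm]

/-- The vertex idempotent `p_x`. -/
noncomputable def p (x : Λ.Vert) : KP R Λ := mk R (KPFree.vert R x)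

/-- The element `s_l` of a path `l`, with `s_l = p_x` if `l` is the path of degree `0` at `x`. -/
noncomputable def s (l : Λ.Path) : KP R Λ :=
  if h : Λ.deg l = 0 then p R (Λ.rng l) else mk R (KPFree.path R ⟨l, h⟩)

/-- The element `s_{l*}` of a path `l`, with `s_{l*} = p_x` if `l` is the path of degree `0` at
`x`. -/
noncomputable def sStar (l : Λ.Path) : KP R Λ :=
  if h : Λ.deg l = 0 then p R (Λ.rng l) else mk R (KPFree.ghost R ⟨l, h⟩)

variable (Λ) in
/-- The homogeneous part of degree `n ∈ ℤᵏ`: the `R`-span of all `s_l s_{μ*}` with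
`deg l - deg μ = n`. -/
noncomputable def homogeneous (n : Fin k → ℤ) : Submodule R (KP R Λ) :=
  Submodule.span R {a | ∃ l μ : Λ.Path,
    (∀ i, (Λ.deg l i : ℤ) - (Λ.deg μ i : ℤ) = n i) ∧ a = s R l * sStar R μ}

variable {R}

/-- The ideal `I` is graded: the subgroups `I ∩ KP_R(Λ)_n` form a `ℤᵏ`-grading of `I`. -/
def IsGraded (I : TwoSidedIdeal (KP R Λ)) : Prop :=
  (∀ (m n : Fin k → ℤ) (a b : KP R Λ), a ∈ I → a ∈ homogeneous R Λ m →
    b ∈ I → b ∈ homogeneous R Λ n → a * b ∈ homogeneous R Λ (m + n)) ∧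
  ∀ a ∈ I, ∃! c : (Fin k → ℤ) →₀ KP R Λ,
    (∀ n, c n ∈ I ∧ c n ∈ homogeneous R Λ n) ∧ (c.sum fun _ b => b) = a

/-- The ideal `I` is basic: `r p_x ∈ I` and `r ≠ 0` imply `p_x ∈ I`. -/
def IsBasic (I : TwoSidedIdeal (KP R Λ)) : Prop :=
  ∀ (r : R) (x : Λ.Vert), r ≠ 0 → r • p R x ∈ I → p R x ∈ I

variable (R)

/-- The ideal `I_H` generated by the `p_x` with `x ∈ H`. -/
noncomputable def vertexIdeal (H : Λ.SatHer) : TwoSidedIdeal (KP R Λ) :=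
  TwoSidedIdeal.span (p R '' H.carrier)

variable (Λ)

/-- The basic ideals of `KP_R(Λ)`. -/
@[ext]
structure BasicIdeal where
  ideal : TwoSidedIdeal (KP R Λ)
  basic : IsBasic ideal

variable {R Λ}

namespace BasicIdeal

/-- Basic ideals are ordered by inclusion. -/
noncomputable instance : PartialOrder (BasicIdeal R Λ) :=
  PartialOrder.lift BasicIdeal.ideal (fun _ _ h => BasicIdeal.ext h)

noncomputable instance : InfSet (BasicIdeal R Λ) where
  sInf S :=
    { ideal := sInf (BasicIdeal.ideal '' S)
      basic := by
        intro r x hr h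
        rw [TwoSidedIdeal.mem_sInf] at h ⊢
        rintro _ ⟨I, hI, rfl⟩
        exact I.basic r x hr (h _ ⟨I, hI, rfl⟩) }

/-- The lattice of basic ideals; meets are intersections, and the join of a family is the smallest
basic ideal containing all its members. -/
noncomputable instance : CompleteLattice (BasicIdeal R Λ) :=
  completeLatticeOfInf (BasicIdeal R Λ) fun _ =>
    ⟨fun I hI => sInf_le (a := I.ideal) (Set.mem_image_of_mem _ hI),
      fun J hJ => le_sInf (a := J.ideal) (by rintro _ ⟨I, hI, rfl⟩; exact hJ hI)⟩

end BasicIdeal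

end KP

/-! The inverse of `H ↦ I_H` is `I ↦ {v | p_v ∈ I}`, and three facts carry the theorem.

Detection: for saturated hereditary `H` the algebra acts on the `R`-valued functions on infinite
paths that avoid `H` (`rep`). The action kills `p_v` for `v ∈ H`. For `v ∉ H` and `r ≠ 0` it does
not kill `r p_v`, because saturation lets an infinite path start at `v` and stay outside `H`. Hence
the kernel of `rep` is basic. It contains `I_H`, so `I_H` is basic too and contains no vertex
idempotent from outside `H`. Being generated in degree `0`, `I_H` is graded.

Uniqueness (`IsBasic.eq_vertexIdeal`): let `I` be basic with vertex set `H` and `Λ ∖ H` aperiodic.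
An element of `I` is a combination of `s_α s_{β*}` with all `β` of one degree. If a term with
nonzero coefficient `r` had its source outside `H`, compressing by `s_{(αl)*}` and `s_{βl}`, for a
path `l` supplied by aperiodicity, would kill all other terms and leave `r p_{s(l)} ∈ I` with `s(l)
∉ H`, contradicting basicness. So `I = I_H`. The argument runs inside `KP_R(Λ)`, without passing to
a quotient algebra.

Converse (`not_isGraded_ker_rep`): if `Λ ∖ H` is not aperiodic, all infinite paths from some vertex
share a period, and two initial segments `κ`, `l` of one such path have different degrees but act
identically. Then `s_l - s_κ` lies in the kernel of `rep`. If this basic ideal were graded it would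
contain `s_l`, hence `p_{s(l)}`, although `s(l) ∉ H`. -/

namespace KGraph

variable {k : ℕ} {Λ : KGraph.{u, v} k}

/-! ### Unique factorization: initial segments, remainders and segments of paths -/

theorem comp_congr {μ μ' ν ν' : Λ.Path} (hμ : μ = μ') (hν : ν = ν') (h : Λ.src μ = Λ.rng ν) :
    Λ.comp μ ν h = Λ.comp μ' ν' (hμ ▸ hν ▸ h) := by
  subst hμ hν; rfl

/-- Unique factorization: two factorizations with initial parts of equal degree agree. -/
theorem comp_inj {μ ν μ' ν' : Λ.Path} {h : Λ.src μ = Λ.rng ν} {h' : Λ.src μ' = Λ.rng ν'}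
    (hd : Λ.deg μ = Λ.deg μ') (e : Λ.comp μ ν h = Λ.comp μ' ν' h') : μ = μ' ∧ ν = ν' := by
  have hd' : Λ.deg ν = Λ.deg ν' := by
    have := congrArg Λ.deg e
    rw [Λ.deg_comp, Λ.deg_comp, hd] at this
    exact add_left_cancel this
  have := (Λ.factorization _ _ _ (Λ.deg_comp μ ν h)).unique (y₁ := (μ, ν)) (y₂ := (μ', ν'))
    ⟨rfl, rfl, h, rfl⟩ ⟨hd.symm, hd'.symm, h', e.symm⟩
  exact Prod.mk.inj this

/-- Composing with an identity on either side gives two factorizations of `l` whose initial parts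
both have degree `0`. -/
theorem eq_id_of_deg_eq_zero {l : Λ.Path} (h : Λ.deg l = 0) : l = Λ.id (Λ.rng l) := by
  have e : Λ.comp l (Λ.id (Λ.src l)) (Λ.rng_id _).symm =
      Λ.comp (Λ.id (Λ.rng l)) l (Λ.src_id _) := by rw [Λ.comp_id, Λ.id_comp]
  exact (comp_inj (by rw [h, Λ.deg_id]) e).1

theorem src_eq_rng_of_deg_eq_zero {l : Λ.Path} (h : Λ.deg l = 0) : Λ.src l = Λ.rng l := by
  rw [eq_id_of_deg_eq_zero h, Λ.src_id, Λ.rng_id]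

theorem exists_factorization (l : Λ.Path) {p : Fin k → ℕ} (hp : p ≤ Λ.deg l) :
    ∃ (μ ν : Λ.Path) (h : Λ.src μ = Λ.rng ν), Λ.deg μ = p ∧ Λ.comp μ ν h = l := by
  obtain ⟨⟨μ, ν⟩, ⟨h1, -, h3, h4⟩, -⟩ :=
    Λ.factorization l p (Λ.deg l - p) (add_tsub_cancel_of_le hp).symm
  exact ⟨μ, ν, h3, h1, h4⟩

open Classical in
/-- The initial segment of `l` of degree `p` (`l` itself unless `p ≤ deg l`). -/
noncomputable def pre (l : Λ.Path) (p : Fin k → ℕ) : Λ.Path :=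
  if hp : p ≤ Λ.deg l then (exists_factorization l hp).choose else l

open Classical in
/-- What remains of `l` after its initial segment of degree `p` (`l` itself unless
`p ≤ deg l`). -/
noncomputable def suf (l : Λ.Path) (p : Fin k → ℕ) : Λ.Path :=
  if hp : p ≤ Λ.deg l then (exists_factorization l hp).choose_spec.choose else l

section

variable {l : Λ.Path} {p : Fin k → ℕ}

theorem src_pre (hp : p ≤ Λ.deg l) : Λ.src (pre l p) = Λ.rng (suf l p) := by
  rw [pre, suf, dif_pos hp, dif_pos hp]
  exact (exists_factorization l hp).choose_spec.choose_spec.choose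

theorem deg_pre (hp : p ≤ Λ.deg l) : Λ.deg (pre l p) = p := by
  rw [pre, dif_pos hp]
  exact (exists_factorization l hp).choose_spec.choose_spec.choose_spec.1

theorem comp_pre_suf (hp : p ≤ Λ.deg l) : Λ.comp (pre l p) (suf l p) (src_pre hp) = l := by
  simp only [pre, suf, dif_pos hp]
  exact (exists_factorization l hp).choose_spec.choose_spec.choose_spec.2

end

theorem le_deg_comp (μ ν : Λ.Path) (h : Λ.src μ = Λ.rng ν) :
    Λ.deg μ ≤ Λ.deg (Λ.comp μ ν h) := by
  rw [Λ.deg_comp]; exact le_self_add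

theorem pre_suf_comp {μ ν : Λ.Path} (h : Λ.src μ = Λ.rng ν) {p : Fin k → ℕ} (hp : Λ.deg μ = p) :
    pre (Λ.comp μ ν h) p = μ ∧ suf (Λ.comp μ ν h) p = ν := by
  subst hp
  exact comp_inj (deg_pre (le_deg_comp μ ν h)) (comp_pre_suf (le_deg_comp μ ν h))

theorem pre_comp {μ ν : Λ.Path} (h : Λ.src μ = Λ.rng ν) {p : Fin k → ℕ} (hp : Λ.deg μ = p) :
    pre (Λ.comp μ ν h) p = μ := (pre_suf_comp h hp).1

theorem suf_comp {μ ν : Λ.Path} (h : Λ.src μ = Λ.rng ν) {p : Fin k → ℕ} (hp : Λ.deg μ = p) :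
    suf (Λ.comp μ ν h) p = ν := (pre_suf_comp h hp).2

theorem rng_pre {l : Λ.Path} {p : Fin k → ℕ} (hp : p ≤ Λ.deg l) :
    Λ.rng (pre l p) = Λ.rng l := by
  conv_rhs => rw [← comp_pre_suf hp, Λ.rng_comp]

theorem src_suf {l : Λ.Path} {p : Fin k → ℕ} (hp : p ≤ Λ.deg l) :
    Λ.src (suf l p) = Λ.src l := by
  conv_rhs => rw [← comp_pre_suf hp, Λ.src_comp]

theorem deg_suf {l : Λ.Path} {p q : Fin k → ℕ} (hp : Λ.deg l = p + q) :
    Λ.deg (suf l p) = q := by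
  have hle : p ≤ Λ.deg l := hp ▸ le_self_add
  have := congrArg Λ.deg (comp_pre_suf hle)
  rw [Λ.deg_comp, deg_pre hle, hp] at this
  exact add_left_cancel this

theorem pre_comp_of_le {μ ν : Λ.Path} (h : Λ.src μ = Λ.rng ν) {p : Fin k → ℕ}
    (hp : p ≤ Λ.deg μ) : pre (Λ.comp μ ν h) p = pre μ p := by
  have h' : Λ.src (suf μ p) = Λ.rng ν := (src_suf hp).trans h
  have : Λ.comp μ ν h = Λ.comp (pre μ p) (Λ.comp (suf μ p) ν h')
      ((src_pre hp).trans (Λ.rng_comp _ _ _).symm) := by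
    rw [← Λ.assoc _ _ _ (src_pre hp) h']
    exact comp_congr (comp_pre_suf hp).symm rfl h
  rw [this, pre_comp _ (deg_pre hp)]

theorem pre_pre {l : Λ.Path} {p q : Fin k → ℕ} (hpq : p ≤ q) (hq : q ≤ Λ.deg l) :
    pre (pre l q) p = pre l p := by
  conv_rhs => rw [← comp_pre_suf hq, pre_comp_of_le _ (hpq.trans (deg_pre hq).ge)]

theorem suf_zero (l : Λ.Path) : suf l 0 = l := by
  conv_lhs => rw [← Λ.id_comp l, suf_comp _ (Λ.deg_id _)]

theorem pre_comp_add {μ ν : Λ.Path} (h : Λ.src μ = Λ.rng ν) {p q : Fin k → ℕ}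
    (hp : Λ.deg μ = p) (hq : q ≤ Λ.deg ν) :
    pre (Λ.comp μ ν h) (p + q) = Λ.comp μ (pre ν q) (h.trans (rng_pre hq).symm) := by
  have h' : Λ.src (Λ.comp μ (pre ν q) (h.trans (rng_pre hq).symm)) = Λ.rng (suf ν q) := by
    rw [Λ.src_comp, src_pre hq]
  have : Λ.comp μ ν h = Λ.comp (Λ.comp μ (pre ν q) (h.trans (rng_pre hq).symm)) (suf ν q) h' := by
    rw [Λ.assoc _ _ _ _ (src_pre hq)]
    exact comp_congr rfl (comp_pre_suf hq).symm h
  rw [this, pre_comp _ (by rw [Λ.deg_comp, hp, deg_pre hq])]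

theorem suf_pre {l : Λ.Path} {p q : Fin k → ℕ} (h : p + q ≤ Λ.deg l) :
    suf (pre l (p + q)) p = pre (suf l p) q := by
  have hp : p ≤ Λ.deg l := le_self_add.trans h
  have hq : q ≤ Λ.deg (suf l p) := by
    rw [deg_suf (add_tsub_cancel_of_le hp).symm]
    exact le_tsub_of_add_le_left h
  conv_lhs => rw [← comp_pre_suf hp, pre_comp_add _ (deg_pre hp) hq, suf_comp _ (deg_pre hp)]

theorem suf_suf {l : Λ.Path} {p q : Fin k → ℕ} (h : p + q ≤ Λ.deg l) :
    suf (suf l p) q = suf l (p + q) := by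
  have hp : p ≤ Λ.deg l := le_self_add.trans h
  have hq : q ≤ Λ.deg (suf l p) := by
    rw [deg_suf (add_tsub_cancel_of_le hp).symm]
    exact le_tsub_of_add_le_left h
  have h1 : Λ.src (pre l p) = Λ.rng (pre (suf l p) q) := by rw [rng_pre hq, src_pre hp]
  have : l = Λ.comp (Λ.comp (pre l p) (pre (suf l p) q) h1) (suf (suf l p) q)
      (by rw [Λ.src_comp, src_pre hq]) := by
    rw [Λ.assoc _ _ _ _ (src_pre hq)]
    conv_lhs => rw [← comp_pre_suf hp]
    exact comp_congr rfl (comp_pre_suf hq).symm _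
  conv_rhs => rw [this, suf_comp _ (by rw [Λ.deg_comp, deg_pre hp, deg_pre hq])]

/-- Bridges the relational segments in the definition of aperiodicity and the functions `pre` and
`suf`: the degrees leave no choice for the outer factors. -/
theorem isSegment_iff {l μ : Λ.Path} {p q : Fin k → ℕ} (h : p + q ≤ Λ.deg l) :
    Λ.IsSegment l p (p + q) μ ↔ μ = pre (suf l p) q := by
  have hp : p ≤ Λ.deg l := le_self_add.trans h
  have hq : q ≤ Λ.deg (suf l p) := by
    rw [deg_suf (add_tsub_cancel_of_le hp).symm]
    exact le_tsub_of_add_le_left h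
  constructor
  · rintro ⟨α, β, h₁, h₂, hα, hμ, rfl⟩
    have hμ' : Λ.deg μ = q := add_left_cancel hμ
    rw [← suf_pre h, pre_comp _ (by rw [Λ.deg_comp, hα, hμ']), suf_comp _ hα]
  · rintro rfl
    have h1 : Λ.src (pre l p) = Λ.rng (pre (suf l p) q) := by rw [rng_pre hq, src_pre hp]
    refine ⟨pre l p, suf (suf l p) q, h1, by rw [Λ.src_comp, src_pre hq], deg_pre hp,
      by rw [deg_pre hq], ?_⟩
    rw [Λ.assoc _ _ _ _ (src_pre hq)]
    conv_rhs => rw [← comp_pre_suf hp]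
    exact comp_congr rfl (comp_pre_suf hq) _

/-! ### Infinite paths -/

variable (Λ) in
/-- An infinite path whose vertices lie outside `H`, presented by its initial segments. -/
@[ext]
structure InfPath (H : Set Λ.Vert) where
  seg : (Fin k → ℕ) → Λ.Path
  deg_seg : ∀ n, Λ.deg (seg n) = n
  pre_seg : ∀ {n m}, n ≤ m → pre (seg m) n = seg n
  src_seg : ∀ n, Λ.src (seg n) ∉ H

namespace InfPath

variable {H : Set Λ.Vert}

/-- The range of an infinite path. -/
def rng (x : Λ.InfPath H) : Λ.Vert := Λ.rng (x.seg 0)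

theorem rng_seg (x : Λ.InfPath H) (n : Fin k → ℕ) : Λ.rng (x.seg n) = x.rng := by
  rw [rng, ← x.pre_seg (zero_le (a := n)), rng_pre (zero_le)]

/-- The infinite path obtained by removing the initial segment of degree `p`. -/
noncomputable def shift (p : Fin k → ℕ) (x : Λ.InfPath H) : Λ.InfPath H where
  seg n := suf (x.seg (p + n)) p
  deg_seg n := deg_suf (x.deg_seg _)
  pre_seg {n m} h := by
    have h' : p + n ≤ p + m := by gcongr
    rw [← suf_pre (by rwa [x.deg_seg]), x.pre_seg h']
  src_seg n := by
    rw [src_suf (by rw [x.deg_seg]; exact le_self_add)]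
    exact x.src_seg _

theorem comp_seg_shift (x : Λ.InfPath H) (p n : Fin k → ℕ) :
    ∃ h, Λ.comp (x.seg p) ((x.shift p).seg n) h = x.seg (p + n) := by
  have hp : p ≤ Λ.deg (x.seg (p + n)) := by rw [x.deg_seg]; exact le_self_add
  rw [← x.pre_seg (n := p) (m := p + n) le_self_add]
  exact ⟨src_pre hp, comp_pre_suf hp⟩

theorem rng_shift (x : Λ.InfPath H) (p : Fin k → ℕ) : (x.shift p).rng = Λ.src (x.seg p) := by
  obtain ⟨h, -⟩ := x.comp_seg_shift p 0
  exact h.symm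

theorem shift_shift (x : Λ.InfPath H) (p q : Fin k → ℕ) :
    (x.shift p).shift q = x.shift (p + q) := by
  ext n
  show suf (suf (x.seg (p + (q + n))) p) q = suf (x.seg (p + q + n)) (p + q)
  rw [suf_suf (by rw [x.deg_seg, ← add_assoc]; exact le_self_add), add_assoc]

/-- The infinite path `l x`, for a hereditary set `H`. -/
noncomputable def cat (hH : Λ.Hereditary H) (l : Λ.Path) (x : Λ.InfPath H)
    (h : Λ.src l = x.rng) : Λ.InfPath H where
  -- The path `l x(0, n)` has degree at least `n`, so it is always long enough to be cut at `n`.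
  seg n := pre (Λ.comp l (x.seg n) (h.trans (x.rng_seg n).symm)) n
  deg_seg n := deg_pre (by rw [Λ.deg_comp, x.deg_seg]; exact le_add_self)
  pre_seg {n m} hnm := by
    obtain ⟨q, rfl⟩ := exists_add_of_le hnm
    obtain ⟨h', e⟩ := x.comp_seg_shift n q
    rw [pre_pre hnm (by rw [Λ.deg_comp, x.deg_seg]; exact le_add_self),
      comp_congr rfl e.symm, ← Λ.assoc _ _ _ (h.trans (x.rng_seg n).symm) h',
      pre_comp_of_le _ (by rw [Λ.deg_comp, x.deg_seg]; exact le_add_self)]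
  src_seg n hn := by
    have hle : n ≤ Λ.deg (Λ.comp l (x.seg n) (h.trans (x.rng_seg n).symm)) := by
      rw [Λ.deg_comp, x.deg_seg]; exact le_add_self
    rw [src_pre hle] at hn
    have := hH _ hn
    rw [src_suf hle, Λ.src_comp] at this
    exact x.src_seg n this

variable (hH : Λ.Hereditary H)

theorem seg_cat (l : Λ.Path) (x : Λ.InfPath H) (h : Λ.src l = x.rng) (n : Fin k → ℕ) :
    (cat hH l x h).seg (Λ.deg l + n) = Λ.comp l (x.seg n) (h.trans (x.rng_seg n).symm) := by
  have hn : n ≤ Λ.deg (x.seg (Λ.deg l + n)) := by rw [x.deg_seg]; exact le_add_self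
  show pre _ _ = _
  rw [pre_comp_add _ rfl hn]
  exact comp_congr rfl (x.pre_seg le_add_self) _

theorem seg_cat_deg (l : Λ.Path) (x : Λ.InfPath H) (h : Λ.src l = x.rng) :
    (cat hH l x h).seg (Λ.deg l) = l :=
  pre_comp _ rfl

theorem rng_cat (l : Λ.Path) (x : Λ.InfPath H) (h : Λ.src l = x.rng) :
    (cat hH l x h).rng = Λ.rng l := by
  rw [← rng_seg _ (Λ.deg l), seg_cat_deg]

/-- Infinite paths are determined by a cofinal family of initial segments. -/
theorem ext_add {x y : Λ.InfPath H} (p : Fin k → ℕ)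
    (h : ∀ n, x.seg (p + n) = y.seg (p + n)) : x = y := by
  ext n
  rw [← x.pre_seg (n := n) (m := p + n) le_add_self, h, y.pre_seg le_add_self]

theorem shift_cat (l : Λ.Path) (x : Λ.InfPath H) (h : Λ.src l = x.rng) :
    (cat hH l x h).shift (Λ.deg l) = x := by
  ext n
  show suf _ _ = _
  rw [seg_cat, suf_comp _ rfl]

theorem cat_shift (x : Λ.InfPath H) (p : Fin k → ℕ) :
    cat hH (x.seg p) (x.shift p) (x.rng_shift p).symm = x := by
  refine ext_add p fun n => ?_
  obtain ⟨h, e⟩ := x.comp_seg_shift p n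
  have := seg_cat hH (x.seg p) (x.shift p) (x.rng_shift p).symm n
  rw [x.deg_seg p] at this
  exact this.trans e

theorem cat_comp (μ ν : Λ.Path) (h : Λ.src μ = Λ.rng ν) (x : Λ.InfPath H)
    (hx : Λ.src (Λ.comp μ ν h) = x.rng) :
    cat hH (Λ.comp μ ν h) x hx =
      cat hH μ (cat hH ν x (by rwa [Λ.src_comp] at hx)) (by rw [rng_cat, h]) := by
  have hx' : Λ.src ν = x.rng := by rwa [Λ.src_comp] at hx
  refine ext_add (Λ.deg (Λ.comp μ ν h)) fun n => ?_
  rw [seg_cat, Λ.deg_comp, add_assoc, seg_cat, Λ.assoc _ _ _ _ (hx'.trans (x.rng_seg n).symm)]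
  exact comp_congr rfl (seg_cat hH ν x hx' n).symm _

/-- Needed for `s_{μν} = s_μ s_ν` in the representation: beginning with `μν` can be tested in two
stages. -/
theorem seg_add_eq_comp_iff (x : Λ.InfPath H) (μ ν : Λ.Path) (h : Λ.src μ = Λ.rng ν) :
    x.seg (Λ.deg (Λ.comp μ ν h)) = Λ.comp μ ν h ↔
      x.seg (Λ.deg μ) = μ ∧ (x.shift (Λ.deg μ)).seg (Λ.deg ν) = ν := by
  obtain ⟨h', e⟩ := x.comp_seg_shift (Λ.deg μ) (Λ.deg ν)
  rw [Λ.deg_comp, ← e]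
  refine ⟨fun e' => comp_inj (x.deg_seg _) e', fun e' => comp_congr e'.1 e'.2 _⟩

/-- A path of degree `(j, …, j)` outside `H` starting at a vertex outside a saturated set `H`. -/
noncomputable def diagonal (hs : Λ.Saturated H) (x : Λ.Vert) (hx : x ∉ H) :
    ℕ → {l : Λ.Path // Λ.src l ∉ H}
  | 0 => ⟨Λ.id x, by rwa [Λ.src_id]⟩
  | j + 1 =>
    -- Saturation in degree `(1, …, 1)`, read contrapositively: a vertex outside `H` emits a path of
    -- this degree whose source is again outside `H`.
    have h := not_forall.1 (mt (hs _ 1) (diagonal hs x hx j).2)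
    have h' := not_forall.1 h.choose_spec
    ⟨Λ.comp (diagonal hs x hx j).1 h.choose h'.choose.symm, by
      rw [Λ.src_comp]; exact (Classical.not_imp.1 h'.choose_spec).2⟩

theorem diagonal_succ (hs : Λ.Saturated H) (x : Λ.Vert) (hx : x ∉ H) (j : ℕ) :
    ∃ (e : Λ.Path) (h : Λ.src (diagonal hs x hx j).1 = Λ.rng e), Λ.deg e = 1 ∧
      (diagonal hs x hx (j + 1)).1 = Λ.comp (diagonal hs x hx j).1 e h := by
  have h := not_forall.1 (mt (hs _ 1) (diagonal hs x hx j).2)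
  have h' := not_forall.1 h.choose_spec
  exact ⟨h.choose, h'.choose.symm, (Classical.not_imp.1 h'.choose_spec).1, rfl⟩

theorem deg_diagonal (hs : Λ.Saturated H) (x : Λ.Vert) (hx : x ∉ H) (j : ℕ) :
    Λ.deg (diagonal hs x hx j).1 = fun _ => j := by
  induction j with
  | zero => exact Λ.deg_id x
  | succ j ih =>
    obtain ⟨e, h, he, hj⟩ := diagonal_succ hs x hx j
    rw [hj, Λ.deg_comp, ih, he]; rfl

theorem pre_diagonal (hs : Λ.Saturated H) (x : Λ.Vert) (hx : x ∉ H) {i j : ℕ} (hij : i ≤ j)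
    {n : Fin k → ℕ} (hn : n ≤ fun _ => i) :
    pre (diagonal hs x hx j).1 n = pre (diagonal hs x hx i).1 n := by
  induction j, hij using Nat.le_induction with
  | base => rfl
  | succ j hij ih =>
    obtain ⟨e, h, he, hj⟩ := diagonal_succ hs x hx j
    rw [hj, pre_comp_of_le, ih]
    rw [deg_diagonal]
    exact hn.trans fun _ => hij

/-- The diagonal paths extend one another, and the one of degree `(j, …, j)` with `j = ∑ i, n i`
dominates `n`, so its initial segment of degree `n` may serve as `x(0, n)`. Heredity keeps the
sources of these segments outside `H`. -/
theorem exists_rng_eq (hH : Λ.Hereditary H) (hs : Λ.Saturated H) {x : Λ.Vert} (hx : x ∉ H) :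
    ∃ y : Λ.InfPath H, y.rng = x := by
  have hsum : ∀ n : Fin k → ℕ, n ≤ fun _ => ∑ i, n i := fun n i =>
    Finset.single_le_sum (fun _ _ => Nat.zero_le _) (Finset.mem_univ i)
  have hle : ∀ n : Fin k → ℕ, n ≤ Λ.deg (diagonal hs x hx (∑ i, n i)).1 := fun n => by
    rw [deg_diagonal]; exact hsum n
  refine ⟨⟨fun n => pre (diagonal hs x hx (∑ i, n i)).1 n, fun n => deg_pre (hle n),
    fun {n m} hnm => ?_, fun n hn => ?_⟩, ?_⟩
  · rw [pre_pre hnm (hle m)]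
    exact pre_diagonal hs x hx (Finset.sum_le_sum fun i _ => hnm i) (hsum n)
  · rw [src_pre (hle n)] at hn
    have := hH _ hn
    rw [src_suf (hle n)] at this
    exact (diagonal hs x hx _).2 this
  · show Λ.rng (pre (diagonal hs x hx (∑ i : Fin k, 0)).1 0) = x
    rw [rng_pre (zero_le), Finset.sum_const_zero]
    exact Λ.rng_id x

end InfPath

end KGraph

/-! ### Universal properties of the free algebra and of its quotient -/

namespace KPFree

variable {k : ℕ} {R : Type w} [CommRing R] {Λ : KGraph.{u, v} k}
  {A : Type*} [NonUnitalRing A] [Module R A] [IsScalarTower R A A] [SMulCommClass R A A]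

/-- The homomorphism from the free algebra with prescribed values on the letters. -/
noncomputable def lift (f : Λ.Gen → A) : KPFree R Λ →ₙₐ[R] A :=
  MonoidAlgebra.liftMagma R (FreeSemigroup.lift f)

@[simp]
theorem lift_letter (f : Λ.Gen → A) (g : Λ.Gen) : lift f (letter R g) = f g := by
  simp [lift, letter]

/-- The relation ideal is an infimum, so it is enough that the kernel belongs to the family: it
contains the relators and is stable under scalars. -/
theorem lift_eq_zero {f : Λ.Gen → A} (hf : ∀ a, Relator R a → lift f a = 0) {a : KPFree R Λ}
    (ha : a ∈ relIdeal R Λ) : lift f a = 0 := by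
  have : relIdeal R Λ ≤ TwoSidedIdeal.ker (lift (R := R) f) :=
    sInf_le ⟨fun a ha => (TwoSidedIdeal.mem_ker _).2 (hf a ha), fun r a ha =>
      (TwoSidedIdeal.mem_ker _).2 (by rw [map_smul, (TwoSidedIdeal.mem_ker _).1 ha, smul_zero])⟩
  exact (TwoSidedIdeal.mem_ker _).1 (this ha)

theorem relator_mem {a : KPFree R Λ} (ha : Relator R a) : a ∈ relIdeal R Λ := by
  rw [relIdeal, TwoSidedIdeal.mem_sInf]
  exact fun I hI => hI.1 a ha

end KPFree

namespace KP

open KGraph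

variable {k : ℕ} {R : Type w} [CommRing R] {Λ : KGraph.{u, v} k}

section lift

variable {A : Type*} [NonUnitalRing A] [Module R A] [IsScalarTower R A A] [SMulCommClass R A A]

/-- The universal property of the Kumjian–Pask algebra. -/
noncomputable def lift (f : Λ.Gen → A)
    (hf : ∀ a, KPFree.Relator R a → KPFree.lift f a = 0) : KP R Λ →ₙₐ[R] A where
  toFun := Quotient.lift (KPFree.lift (R := R) f) fun a b h => by
    rw [← sub_eq_zero, ← map_sub]
    exact KPFree.lift_eq_zero hf ((TwoSidedIdeal.rel_iff _ _ _).1 h)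
  map_smul' r x := by
    obtain ⟨a, rfl⟩ := mk_surjective R x
    exact map_smul (KPFree.lift (R := R) f) r a
  map_zero' := map_zero (KPFree.lift (R := R) f)
  map_add' x y := by
    obtain ⟨a, rfl⟩ := mk_surjective R x
    obtain ⟨b, rfl⟩ := mk_surjective R y
    exact map_add (KPFree.lift (R := R) f) a b
  map_mul' x y := by
    obtain ⟨a, rfl⟩ := mk_surjective R x
    obtain ⟨b, rfl⟩ := mk_surjective R y
    exact map_mul (KPFree.lift (R := R) f) a b

theorem lift_mk_letter (f : Λ.Gen → A) (hf : ∀ a, KPFree.Relator R a → KPFree.lift f a = 0)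
    (g : Λ.Gen) : lift f hf (mk R (KPFree.letter R g)) = f g :=
  KPFree.lift_letter f g

end lift

/-! ### The Kumjian–Pask relations for paths of arbitrary degree -/

theorem mk_eq_zero_of_relator {a : KPFree R Λ} (ha : KPFree.Relator R a) : mk R a = 0 := by
  have := (mk_eq_iff R (a := a) (b := 0)).2 (by rw [sub_zero]; exact KPFree.relator_mem ha)
  exact this

theorem mk_eq_of_relator {a b : KPFree R Λ} (h : KPFree.Relator R (a - b)) : mk R a = mk R b :=
  (mk_eq_iff R).2 (KPFree.relator_mem h)

/-- The quotient map as a linear map. -/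
noncomputable def mkHom : KPFree R Λ →ₗ[R] KP R Λ where
  toFun := mk R
  map_add' := mk_add R
  map_smul' := mk_smul R

theorem p_mul_self (x : Λ.Vert) : p R x * p R x = p R x :=
  mk_eq_of_relator (KPFree.Relator.vert_idem x)

theorem p_mul_p {x y : Λ.Vert} (h : x ≠ y) : p R x * p R y = 0 :=
  mk_eq_zero_of_relator (KPFree.Relator.vert_orth x y h)

theorem s_of_deg_eq_zero {l : Λ.Path} (h : Λ.deg l = 0) : s R l = p R (Λ.rng l) := dif_pos h

theorem sStar_of_deg_eq_zero {l : Λ.Path} (h : Λ.deg l = 0) : sStar R l = p R (Λ.rng l) :=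
  dif_pos h

theorem s_of_deg_ne_zero {l : Λ.Path} (h : Λ.deg l ≠ 0) :
    s R l = mk R (KPFree.path R ⟨l, h⟩) := dif_neg h

theorem sStar_of_deg_ne_zero {l : Λ.Path} (h : Λ.deg l ≠ 0) :
    sStar R l = mk R (KPFree.ghost R ⟨l, h⟩) := dif_neg h

theorem s_id (x : Λ.Vert) : s R (Λ.id x) = p R x := by
  rw [s_of_deg_eq_zero (Λ.deg_id x), Λ.rng_id]

theorem sStar_id (x : Λ.Vert) : sStar R (Λ.id x) = p R x := by
  rw [sStar_of_deg_eq_zero (Λ.deg_id x), Λ.rng_id]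

theorem p_mul_s (l : Λ.Path) : p R (Λ.rng l) * s R l = s R l := by
  by_cases h : Λ.deg l = 0
  · rw [s_of_deg_eq_zero h, p_mul_self]
  · rw [s_of_deg_ne_zero h]
    exact mk_eq_of_relator (KPFree.Relator.rng_path ⟨l, h⟩)

theorem s_mul_p (l : Λ.Path) : s R l * p R (Λ.src l) = s R l := by
  by_cases h : Λ.deg l = 0
  · rw [s_of_deg_eq_zero h, src_eq_rng_of_deg_eq_zero h, p_mul_self]
  · rw [s_of_deg_ne_zero h]
    exact (mk_eq_of_relator (KPFree.Relator.path_src ⟨l, h⟩)).symm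

theorem p_mul_sStar (l : Λ.Path) : p R (Λ.src l) * sStar R l = sStar R l := by
  by_cases h : Λ.deg l = 0
  · rw [sStar_of_deg_eq_zero h, src_eq_rng_of_deg_eq_zero h, p_mul_self]
  · rw [sStar_of_deg_ne_zero h]
    exact mk_eq_of_relator (KPFree.Relator.src_ghost ⟨l, h⟩)

theorem sStar_mul_p (l : Λ.Path) : sStar R l * p R (Λ.rng l) = sStar R l := by
  by_cases h : Λ.deg l = 0
  · rw [sStar_of_deg_eq_zero h, p_mul_self]
  · rw [sStar_of_deg_ne_zero h]
    exact (mk_eq_of_relator (KPFree.Relator.ghost_rng ⟨l, h⟩)).symm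

theorem s_comp (μ ν : Λ.Path) (h : Λ.src μ = Λ.rng ν) :
    s R (Λ.comp μ ν h) = s R μ * s R ν := by
  by_cases hμ : Λ.deg μ = 0
  · have e : μ = Λ.id (Λ.rng ν) := by
      rw [eq_id_of_deg_eq_zero hμ, ← src_eq_rng_of_deg_eq_zero hμ, h]
    rw [comp_congr e rfl, Λ.id_comp, e, s_id, p_mul_s]
  by_cases hν : Λ.deg ν = 0
  · have e : ν = Λ.id (Λ.src μ) := by rw [h, ← eq_id_of_deg_eq_zero hν]
    rw [comp_congr rfl e, Λ.comp_id, e, s_id, s_mul_p]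
  have hc : Λ.deg (Λ.comp μ ν h) ≠ 0 := by
    rw [Λ.deg_comp]; exact fun h0 => hμ (add_eq_zero.1 h0).1
  rw [s_of_deg_ne_zero hc, s_of_deg_ne_zero hμ, s_of_deg_ne_zero hν]
  exact mk_eq_of_relator (KPFree.Relator.path_comp ⟨_, hc⟩ ⟨μ, hμ⟩ ⟨ν, hν⟩ h rfl)

theorem sStar_comp (μ ν : Λ.Path) (h : Λ.src μ = Λ.rng ν) :
    sStar R (Λ.comp μ ν h) = sStar R ν * sStar R μ := by
  by_cases hμ : Λ.deg μ = 0
  · have e : μ = Λ.id (Λ.rng ν) := by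
      rw [eq_id_of_deg_eq_zero hμ, ← src_eq_rng_of_deg_eq_zero hμ, h]
    rw [comp_congr e rfl, Λ.id_comp, e, sStar_id, sStar_mul_p]
  by_cases hν : Λ.deg ν = 0
  · have e : ν = Λ.id (Λ.src μ) := by rw [h, ← eq_id_of_deg_eq_zero hν]
    rw [comp_congr rfl e, Λ.comp_id, e, sStar_id, p_mul_sStar]
  have hc : Λ.deg (Λ.comp μ ν h) ≠ 0 := by
    rw [Λ.deg_comp]; exact fun h0 => hμ (add_eq_zero.1 h0).1
  rw [sStar_of_deg_ne_zero hc, sStar_of_deg_ne_zero hμ, sStar_of_deg_ne_zero hν]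
  exact mk_eq_of_relator (KPFree.Relator.ghost_comp ⟨_, hc⟩ ⟨μ, hμ⟩ ⟨ν, hν⟩ h rfl)

theorem sStar_mul_s_self (l : Λ.Path) : sStar R l * s R l = p R (Λ.src l) := by
  by_cases h : Λ.deg l = 0
  · rw [s_of_deg_eq_zero h, sStar_of_deg_eq_zero h, p_mul_self, src_eq_rng_of_deg_eq_zero h]
  · rw [s_of_deg_ne_zero h, sStar_of_deg_ne_zero h]
    exact mk_eq_of_relator (KPFree.Relator.ghost_path_self ⟨l, h⟩)

theorem sStar_mul_s_of_ne {l μ : Λ.Path} (hd : Λ.deg l = Λ.deg μ) (hne : l ≠ μ) :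
    sStar R l * s R μ = 0 := by
  by_cases h : Λ.deg l = 0
  · rw [sStar_of_deg_eq_zero h, s_of_deg_eq_zero (hd ▸ h), p_mul_p]
    intro e
    have hμ : Λ.deg μ = 0 := hd ▸ h
    exact hne (by rw [eq_id_of_deg_eq_zero h, e, ← eq_id_of_deg_eq_zero hμ])
  · rw [sStar_of_deg_ne_zero h, s_of_deg_ne_zero (hd ▸ h)]
    exact mk_eq_zero_of_relator (KPFree.Relator.ghost_path_ne ⟨l, h⟩ ⟨μ, hd ▸ h⟩ hd
      fun e => hne (congrArg Subtype.val e))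

theorem mem_paths (hfin : Λ.RowFinite) {x : Λ.Vert} {n : Fin k → ℕ} {l : Λ.Path} :
    l ∈ (hfin x n).toFinset ↔ Λ.rng l = x ∧ Λ.deg l = n :=
  Set.Finite.mem_toFinset _

/-- In degree `0` the only path is the identity. Otherwise the finite set of paths is transported to
`PosPath`, where the relator lives. -/
theorem p_eq_sum (hfin : Λ.RowFinite) (x : Λ.Vert) (n : Fin k → ℕ) :
    p R x = ∑ l ∈ (hfin x n).toFinset, s R l * sStar R l := by
  by_cases hn : n = 0
  · subst hn
    have : (hfin x 0).toFinset = {Λ.id x} := by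
      ext l
      rw [mem_paths, Finset.mem_singleton]
      constructor
      · rintro ⟨rfl, h⟩
        exact eq_id_of_deg_eq_zero h
      · rintro rfl
        exact ⟨Λ.rng_id x, Λ.deg_id x⟩
    rw [this, Finset.sum_singleton, s_id, sStar_id, p_mul_self]
  · have hpos : ∀ l ∈ (hfin x n).toFinset, Λ.deg l ≠ 0 := fun l hl => by
      rw [mem_paths] at hl
      rw [hl.2]; exact hn
    let f : {l // l ∈ (hfin x n).toFinset} ↪ Λ.PosPath :=
      ⟨fun l => ⟨l.1, hpos l.1 l.2⟩, fun a b h => Subtype.ext (Subtype.mk.inj h)⟩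
    have := mk_eq_of_relator (KPFree.Relator.sum_path_ghost (R := R) x n hn
      ((hfin x n).toFinset.attach.map f) fun l => by
        constructor
        · intro hl
          obtain ⟨a, -, rfl⟩ := Finset.mem_map.1 hl
          exact (mem_paths hfin).1 a.2
        · intro hl
          exact Finset.mem_map.2 ⟨⟨l.1, (mem_paths hfin).2 hl⟩,
            Finset.mem_attach _ _, rfl⟩)
    refine this.trans ?_
    rw [← Finset.sum_attach (hfin x n).toFinset, Finset.sum_map]
    refine (map_sum (mkHom (R := R) (Λ := Λ)) _ _).trans (Finset.sum_congr rfl fun l _ => ?_)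
    rw [s_of_deg_ne_zero (hpos l.1 l.2), sStar_of_deg_ne_zero (hpos l.1 l.2), ← mk_mul]
    rfl

/-! ### Spanning by the products `s_α s_{β*}` and normal forms -/

theorem s_mul_s_of_ne {μ ν : Λ.Path} (h : Λ.src μ ≠ Λ.rng ν) : s R μ * s R ν = 0 := by
  rw [← s_mul_p μ, ← p_mul_s ν, mul_assoc, ← mul_assoc (p R _) (p R _), p_mul_p h, zero_mul,
    mul_zero]

theorem sStar_mul_sStar_of_ne {μ ν : Λ.Path} (h : Λ.src μ ≠ Λ.rng ν) :
    sStar R ν * sStar R μ = 0 := by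
  rw [← sStar_mul_p ν, ← p_mul_sStar μ, mul_assoc, ← mul_assoc (p R _) (p R _), p_mul_p h.symm,
    zero_mul, mul_zero]

theorem s_mul_sStar_of_ne {μ ν : Λ.Path} (h : Λ.src μ ≠ Λ.src ν) :
    s R μ * sStar R ν = 0 := by
  rw [← s_mul_p μ, ← p_mul_sStar ν, mul_assoc, ← mul_assoc (p R _) (p R _), p_mul_p h,
    zero_mul, mul_zero]

/-- A product `s_α s_{β*}` with `src α ≠ src β` vanishes, so membership in a submodule may be
checked under the assumption `src α = src β`. -/
theorem s_mul_sStar_mem {M : Submodule R (KP R Λ)} {α β : Λ.Path}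
    (h : Λ.src α = Λ.src β → s R α * sStar R β ∈ M) : s R α * sStar R β ∈ M := by
  by_cases e : Λ.src α = Λ.src β
  · exact h e
  · rw [s_mul_sStar_of_ne e]; exact M.zero_mem

variable (R Λ) in
/-- The span of the products `s_α s_{β*}`. -/
noncomputable def normalSpan : Submodule R (KP R Λ) :=
  Submodule.span R (Set.range fun q : Λ.Path × Λ.Path => s R q.1 * sStar R q.2)

theorem mem_normalSpan (α β : Λ.Path) : s R α * sStar R β ∈ normalSpan R Λ :=
  Submodule.subset_span ⟨(α, β), rfl⟩

/-- Splitting the source projection of `μ` in degree `deg β` makes every `μν` at least as long as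
`β`, so that `s_{β*} s_{μν}` can be reduced. -/
theorem sStar_mul_s_eq_sum (hfin : Λ.RowFinite) (β μ : Λ.Path) :
    sStar R β * s R μ = ∑ ν ∈ (hfin (Λ.src μ) (Λ.deg β)).toFinset,
      sStar R β * (s R μ * s R ν) * sStar R ν := by
  conv_lhs => rw [← s_mul_p μ, p_eq_sum hfin _ (Λ.deg β), Finset.mul_sum, Finset.mul_sum]
  exact Finset.sum_congr rfl fun ν _ => by simp only [mul_assoc]

theorem s_mul_sStar_mul_s_mem (hfin : Λ.RowFinite) (α β μ : Λ.Path) :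
    s R α * sStar R β * s R μ ∈ normalSpan R Λ := by
  rw [mul_assoc, sStar_mul_s_eq_sum hfin, Finset.mul_sum]
  refine Submodule.sum_mem _ fun ν hν => ?_
  rw [mem_paths] at hν
  rw [← s_comp μ ν hν.1.symm]
  have hle : Λ.deg β ≤ Λ.deg (Λ.comp μ ν hν.1.symm) := by
    rw [Λ.deg_comp, hν.2]; exact le_add_self
  -- Write `μν = β'τ` with `deg β' = deg β`; then `s_{β*} s_{β'}` is a vertex idempotent or zero.
  obtain ⟨β', τ, h, hd, e⟩ := exists_factorization _ hle
  rw [← e, s_comp, ← mul_assoc (sStar R β)]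
  by_cases e : β = β'
  · subst e
    rw [sStar_mul_s_self, h, p_mul_s, ← mul_assoc]
    by_cases h : Λ.src α = Λ.rng τ
    · rw [← s_comp _ _ h]
      exact mem_normalSpan _ _
    · rw [s_mul_s_of_ne h, zero_mul]
      exact Submodule.zero_mem _
  · rw [sStar_mul_s_of_ne hd.symm e, zero_mul, zero_mul, mul_zero]
    exact Submodule.zero_mem _

theorem s_mul_sStar_mul_sStar_mem (α β μ : Λ.Path) :
    s R α * sStar R β * sStar R μ ∈ normalSpan R Λ := by
  rw [mul_assoc]
  by_cases h : Λ.src μ = Λ.rng β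
  · rw [← sStar_comp _ _ h]
    exact mem_normalSpan _ _
  · rw [sStar_mul_sStar_of_ne h, mul_zero]
    exact Submodule.zero_mem _

theorem letter_eq (g : Λ.Gen) : (∃ l, mk R (KPFree.letter R g) = s R l) ∨
    ∃ l, mk R (KPFree.letter R g) = sStar R l := by
  cases g with
  | vert x => exact Or.inl ⟨Λ.id x, (s_id x).symm⟩
  | path l => exact Or.inl ⟨l.1, (s_of_deg_ne_zero l.2).symm⟩
  | ghost l => exact Or.inr ⟨l.1, (sStar_of_deg_ne_zero l.2).symm⟩

theorem mul_letter_mem (hfin : Λ.RowFinite) {a : KP R Λ} (ha : a ∈ normalSpan R Λ)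
    (g : Λ.Gen) : a * mk R (KPFree.letter R g) ∈ normalSpan R Λ := by
  induction ha using Submodule.span_induction with
  | mem a ha =>
    obtain ⟨⟨α, β⟩, rfl⟩ := ha
    obtain ⟨l, hl⟩ | ⟨l, hl⟩ := letter_eq (R := R) g
    · rw [hl]; exact s_mul_sStar_mul_s_mem hfin _ _ _
    · rw [hl]; exact s_mul_sStar_mul_sStar_mem _ _ _
  | zero => rw [zero_mul]; exact Submodule.zero_mem _
  | add a b _ _ ha hb => rw [add_mul]; exact Submodule.add_mem _ ha hb
  | smul r a _ ha => rw [smul_mul_assoc]; exact Submodule.smul_mem _ r ha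

theorem letter_mem (g : Λ.Gen) : mk R (KPFree.letter R g) ∈ normalSpan R Λ := by
  obtain ⟨l, hl⟩ | ⟨l, hl⟩ := letter_eq (R := R) g
  · rw [hl, ← s_mul_p, ← sStar_id]; exact mem_normalSpan _ _
  · rw [hl, ← p_mul_sStar, ← s_id]; exact mem_normalSpan _ _

theorem mem_normalSpan_of_rowFinite (hfin : Λ.RowFinite) (a : KP R Λ) : a ∈ normalSpan R Λ := by
  -- In the absence of a unit, stability under right multiplication by a word does not give
  -- membership of the word itself, so the induction carries both.
  have hword : ∀ w : FreeSemigroup Λ.Gen,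
      mk R (MonoidAlgebra.single w (1 : R)) ∈ normalSpan R Λ ∧
      ∀ b ∈ normalSpan R Λ, b * mk R (MonoidAlgebra.single w (1 : R)) ∈ normalSpan R Λ := by
    intro w
    induction w using FreeSemigroup.recOnMul with
    | ih1 g => exact ⟨letter_mem g, fun b hb => mul_letter_mem hfin hb g⟩
    | ih2 g w h1 h2 =>
      have e : mk R (MonoidAlgebra.single (FreeSemigroup.of g * w) (1 : R)) =
          mk R (KPFree.letter R g) * mk R (MonoidAlgebra.single w (1 : R)) := by
        rw [← mk_mul, KPFree.letter, MonoidAlgebra.single_mul_single, one_mul]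
      rw [e]
      exact ⟨h2.2 _ h1.1, fun b hb => by rw [← mul_assoc]; exact h2.2 _ (h1.2 b hb)⟩
  obtain ⟨a, rfl⟩ := mk_surjective R a
  induction a using MonoidAlgebra.induction_linear with
  | zero => exact Submodule.zero_mem _
  | add a b ha hb => rw [mk_add]; exact Submodule.add_mem _ ha hb
  | single w r =>
    have : MonoidAlgebra.single w r = r • MonoidAlgebra.single w (1 : R) := by simp
    rw [this, mk_smul]
    exact Submodule.smul_mem _ r (hword w).1

variable (R Λ) in
/-- The span of the products `s_α s_{β*}` with `src α = src β` and `deg β = N`. -/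
noncomputable def levelSpan (N : Fin k → ℕ) : Submodule R (KP R Λ) :=
  Submodule.span R ((fun q : Λ.Path × Λ.Path => s R q.1 * sStar R q.2) ''
    {q | Λ.src q.1 = Λ.src q.2 ∧ Λ.deg q.2 = N})

/-- Inserting `p_{s(α)} = ∑ s_ν s_{ν*}` over `ν` of degree `N - deg β` lengthens the ghost part to
degree exactly `N`. -/
theorem s_mul_sStar_mem_levelSpan (hfin : Λ.RowFinite) {α β : Λ.Path} {N : Fin k → ℕ}
    (h : Λ.src α = Λ.src β) (hN : Λ.deg β ≤ N) : s R α * sStar R β ∈ levelSpan R Λ N := by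
  rw [← s_mul_p, p_eq_sum hfin _ (N - Λ.deg β), Finset.mul_sum, Finset.sum_mul]
  refine Submodule.sum_mem _ fun ν hν => ?_
  rw [mem_paths] at hν
  rw [← mul_assoc, mul_assoc, ← s_comp α ν hν.1.symm, ← sStar_comp β ν (h.symm.trans hν.1.symm)]
  refine Submodule.subset_span ⟨(_, _), ⟨?_, ?_⟩, rfl⟩
  · rw [Λ.src_comp, Λ.src_comp]
  · rw [Λ.deg_comp, hν.2, add_tsub_cancel_of_le hN]

theorem levelSpan_mono (hfin : Λ.RowFinite) {M N : Fin k → ℕ} (h : M ≤ N) :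
    levelSpan R Λ M ≤ levelSpan R Λ N := by
  refine Submodule.span_le.2 ?_
  rintro _ ⟨q, hq, rfl⟩
  exact s_mul_sStar_mem_levelSpan hfin hq.1 (hq.2.trans_le h)

theorem exists_mem_levelSpan (hfin : Λ.RowFinite) (a : KP R Λ) : ∃ N, a ∈ levelSpan R Λ N := by
  have ha := mem_normalSpan_of_rowFinite hfin a
  induction ha using Submodule.span_induction with
  | mem a ha =>
    obtain ⟨⟨α, β⟩, rfl⟩ := ha
    exact ⟨Λ.deg β, s_mul_sStar_mem fun h => s_mul_sStar_mem_levelSpan hfin h le_rfl⟩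
  | zero => exact ⟨0, Submodule.zero_mem _⟩
  | add a b _ _ ha hb =>
    obtain ⟨M, hM⟩ := ha
    obtain ⟨N, hN⟩ := hb
    exact ⟨M + N, Submodule.add_mem _ (levelSpan_mono hfin le_self_add hM)
      (levelSpan_mono hfin le_add_self hN)⟩
  | smul r a _ ha =>
    obtain ⟨N, hN⟩ := ha
    exact ⟨N, Submodule.smul_mem _ r hN⟩

/-- Every element is a finite combination of products `s_α s_{β*}` with `src α = src β` and all
`β` of one degree. -/
theorem exists_normal_form (hfin : Λ.RowFinite) (a : KP R Λ) :
    ∃ (N : Fin k → ℕ) (c : Λ.Path × Λ.Path →₀ R),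
      (∀ q ∈ c.support, Λ.src q.1 = Λ.src q.2 ∧ Λ.deg q.2 = N) ∧
        a = c.sum fun q r => r • (s R q.1 * sStar R q.2) := by
  obtain ⟨N, hN⟩ := exists_mem_levelSpan hfin a
  obtain ⟨c, hc, rfl⟩ := (Finsupp.mem_span_image_iff_linearCombination R).1 hN
  exact ⟨N, c, fun q hq => hc hq, Finsupp.linearCombination_apply R c⟩

end KP

namespace KP

open KGraph

variable {k : ℕ} {R : Type w} [CommRing R] {Λ : KGraph.{u, v} k}

/-! ### The grading -/

variable (R Λ) in
/-- The target of the coaction that records degrees. -/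
abbrev GradedTarget : Type _ := AddMonoidAlgebra (Unitization R (KP R Λ)) (Fin k → ℤ)

/-- The degree of a path, with integer entries. -/
def intDeg (l : Λ.Path) : Fin k → ℤ := fun i => (Λ.deg l i : ℤ)

theorem intDeg_comp (μ ν : Λ.Path) (h : Λ.src μ = Λ.rng ν) :
    intDeg (Λ.comp μ ν h) = intDeg μ + intDeg ν := by
  ext i; simp [intDeg, Λ.deg_comp]

theorem intDeg_eq_zero {l : Λ.Path} (h : Λ.deg l = 0) : intDeg l = 0 := by
  ext i; simp [intDeg, h]

theorem intDeg_inj {l μ : Λ.Path} : intDeg l = intDeg μ ↔ Λ.deg l = Λ.deg μ := by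
  simp [intDeg, funext_iff]

/-- The degree of a letter. -/
def genDeg : Λ.Gen → Fin k → ℤ
  | .vert _ => 0
  | .path l => intDeg l.1
  | .ghost l => -intDeg l.1

/-- `a` placed in degree `n`. -/
noncomputable def place (n : Fin k → ℤ) : KP R Λ →+ GradedTarget R Λ where
  toFun a := AddMonoidAlgebra.single n (Unitization.inr a)
  map_zero' := by simp
  map_add' a b := by rw [Unitization.inr_add, AddMonoidAlgebra.single_add]

theorem place_mul (m n : Fin k → ℤ) (a b : KP R Λ) :
    place m a * place n b = place (m + n) (a * b) := by
  simp [place, AddMonoidAlgebra.single_mul_single, Unitization.inr_mul]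

theorem place_smul (n : Fin k → ℤ) (r : R) (a : KP R Λ) :
    place n (r • a) = r • place n a := by
  simp [place, Unitization.inr_smul]

theorem snd_coeff_place (m n : Fin k → ℤ) (a : KP R Λ) :
    ((place m a).coeff n).snd = if m = n then a else 0 := by
  simp only [place, AddMonoidHom.coe_mk, ZeroHom.coe_mk, AddMonoidAlgebra.coeff_single,
    Finsupp.single_apply]
  split_ifs <;> simp

/-- The values of the coaction on letters. -/
noncomputable def coactLetter (g : Λ.Gen) : GradedTarget R Λ :=
  place (genDeg g) (mk R (KPFree.letter R g))

/-- Every relator is homogeneous, so it is sent to its own class in `KP R Λ`, placed in a single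
degree, and that class is zero. -/
theorem lift_coactLetter (a : KPFree R Λ) (ha : KPFree.Relator R a) :
    KPFree.lift (coactLetter (R := R)) a = 0 := by
  suffices h : ∃ n, KPFree.lift (coactLetter (R := R)) a = place n (mk R a) by
    obtain ⟨n, h⟩ := h
    rw [h, mk_eq_zero_of_relator ha, map_zero]
  have hl : ∀ g : Λ.Gen, KPFree.lift (coactLetter (R := R)) (KPFree.letter R g) =
      place (genDeg g) (mk R (KPFree.letter R g)) := KPFree.lift_letter _
  have hmul : ∀ g h : Λ.Gen,
      KPFree.lift (coactLetter (R := R)) (KPFree.letter R g * KPFree.letter R h) =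
      place (genDeg g + genDeg h) (mk R (KPFree.letter R g * KPFree.letter R h)) := fun g h => by
    rw [map_mul, hl, hl, place_mul, mk_mul]
  have hsub : ∀ (a b : KPFree R Λ) (n : Fin k → ℤ),
      KPFree.lift (coactLetter (R := R)) a = place n (mk R a) →
      KPFree.lift (coactLetter (R := R)) b = place n (mk R b) →
      ∃ n, KPFree.lift (coactLetter (R := R)) (a - b) = place n (mk R (a - b)) := fun a b n ha hb =>
    ⟨n, by rw [map_sub, ha, hb, ← map_sub]; exact congrArg _ (map_sub mkHom a b).symm⟩
  cases ha with
  | vert_idem x => exact hsub _ _ 0 ((hmul _ _).trans (by simp [genDeg])) (hl _)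
  | vert_orth x y h => exact ⟨_, hmul _ _⟩
  | path_comp l μ ν h e =>
    exact hsub _ _ _ (hl _) ((hmul _ _).trans (by simp only [genDeg, e, intDeg_comp]))
  | ghost_comp l μ ν h e =>
    refine hsub _ _ _ (hl _) ((hmul _ _).trans ?_)
    simp only [genDeg, e, intDeg_comp, neg_add_rev]
  | rng_path l => exact hsub _ _ _ ((hmul _ _).trans (by simp only [genDeg, zero_add])) (hl _)
  | path_src l => exact hsub _ _ _ (hl _) ((hmul _ _).trans (by simp only [genDeg, add_zero]))
  | src_ghost l => exact hsub _ _ _ ((hmul _ _).trans (by simp only [genDeg, zero_add])) (hl _)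
  | ghost_rng l => exact hsub _ _ _ (hl _) ((hmul _ _).trans (by simp only [genDeg, add_zero]))
  | ghost_path_self l =>
    exact hsub _ _ _ ((hmul _ _).trans (by simp only [genDeg, neg_add_cancel])) (hl _)
  | ghost_path_ne l μ hd h => exact ⟨_, hmul _ _⟩
  | sum_path_ghost x n hn t ht =>
    refine hsub _ _ _ (hl _) ?_
    have e : mk R (∑ l ∈ t, KPFree.path R l * KPFree.ghost R l) =
        ∑ l ∈ t, mk R (KPFree.path R l * KPFree.ghost R l) := map_sum mkHom _ _
    rw [map_sum, e, map_sum]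
    exact Finset.sum_congr rfl fun l _ =>
      (hmul _ _).trans (by simp only [genDeg, add_neg_cancel])

variable (R Λ) in
/-- The coaction that records degrees. -/
noncomputable def coact : KP R Λ →ₙₐ[R] GradedTarget R Λ := lift (coactLetter (R := R)) lift_coactLetter

theorem coact_s (l : Λ.Path) : coact R Λ (s R l) = place (intDeg l) (s R l) := by
  by_cases h : Λ.deg l = 0
  · rw [s_of_deg_eq_zero h, intDeg_eq_zero h]
    exact lift_mk_letter (coactLetter (R := R)) lift_coactLetter _
  · rw [s_of_deg_ne_zero h]
    exact lift_mk_letter (coactLetter (R := R)) lift_coactLetter _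

theorem coact_sStar (l : Λ.Path) : coact R Λ (sStar R l) = place (-intDeg l) (sStar R l) := by
  by_cases h : Λ.deg l = 0
  · rw [sStar_of_deg_eq_zero h, intDeg_eq_zero h, neg_zero]
    exact lift_mk_letter (coactLetter (R := R)) lift_coactLetter _
  · rw [sStar_of_deg_ne_zero h]
    exact lift_mk_letter (coactLetter (R := R)) lift_coactLetter _

theorem s_mul_sStar_mem_homogeneous (l μ : Λ.Path) :
    s R l * sStar R μ ∈ homogeneous R Λ (intDeg l - intDeg μ) :=
  Submodule.subset_span ⟨l, μ, fun _ => rfl, rfl⟩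

theorem s_mem_homogeneous (l : Λ.Path) : s R l ∈ homogeneous R Λ (intDeg l) := by
  have := s_mul_sStar_mem_homogeneous (R := R) l (Λ.id (Λ.src l))
  rwa [sStar_id, s_mul_p, intDeg_eq_zero (Λ.deg_id _), sub_zero] at this

theorem p_mem_homogeneous (x : Λ.Vert) : p R x ∈ homogeneous R Λ 0 := by
  have := s_mem_homogeneous (R := R) (Λ.id x)
  rwa [s_id, intDeg_eq_zero (Λ.deg_id _)] at this

theorem coact_of_mem {n : Fin k → ℤ} {a : KP R Λ} (ha : a ∈ homogeneous R Λ n) :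
    coact R Λ a = place n a := by
  induction ha using Submodule.span_induction with
  | mem a ha =>
    obtain ⟨l, μ, hn, rfl⟩ := ha
    have e : intDeg l + -intDeg μ = n := funext fun i =>
      (sub_eq_add_neg _ _).symm.trans (hn i)
    rw [map_mul, coact_s, coact_sStar, place_mul, e]
  | zero => rw [map_zero, map_zero]
  | add a b _ _ ha hb => rw [map_add, map_add, ha, hb]
  | smul r a _ ha => rw [map_smul, ha, place_smul]

variable (R Λ) in
/-- The homogeneous component of degree `n`. -/
noncomputable def component (n : Fin k → ℤ) : KP R Λ →+ KP R Λ where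
  toFun a := ((coact R Λ a).coeff n).snd
  map_zero' := by simp
  map_add' a b := by simp

theorem component_of_mem {m : Fin k → ℤ} {a : KP R Λ} (ha : a ∈ homogeneous R Λ m)
    (n : Fin k → ℤ) : component R Λ n a = if m = n then a else 0 := by
  show ((coact R Λ a).coeff n).snd = _
  rw [coact_of_mem ha, snd_coeff_place]

/-- Directness of the grading: the terms of a homogeneous decomposition are recovered from the sum
by additive maps. -/
theorem component_sum {c : (Fin k → ℤ) →₀ KP R Λ} (hc : ∀ n, c n ∈ homogeneous R Λ n)
    (n : Fin k → ℤ) : component R Λ n (c.sum fun _ b => b) = c n := by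
  rw [Finsupp.sum, map_sum, Finset.sum_congr rfl fun m _ => component_of_mem (hc m) n,
    Finset.sum_ite_eq']
  split_ifs with h
  · rfl
  · exact (Finsupp.notMem_support_iff.1 h).symm

theorem exists_homogeneous_sum (hfin : Λ.RowFinite) (a : KP R Λ) :
    ∃ c : (Fin k → ℤ) →₀ KP R Λ, (∀ n, c n ∈ homogeneous R Λ n) ∧ (c.sum fun _ b => b) = a := by
  have ha : a ∈ ⨆ n, homogeneous R Λ n := by
    refine Submodule.span_le.2 ?_ (mem_normalSpan_of_rowFinite hfin a)
    rintro _ ⟨q, rfl⟩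
    exact Submodule.mem_iSup_of_mem _ (s_mul_sStar_mem_homogeneous q.1 q.2)
  exact (Submodule.mem_iSup_iff_exists_finsupp _ _).1 ha

/-- The coaction is multiplicative, so `a * b` equals its own component of degree `m + n`. By the
existence of homogeneous decompositions, every component is homogeneous of its degree. -/
theorem mul_mem_homogeneous (hfin : Λ.RowFinite) {m n : Fin k → ℤ} {a b : KP R Λ}
    (ha : a ∈ homogeneous R Λ m) (hb : b ∈ homogeneous R Λ n) :
    a * b ∈ homogeneous R Λ (m + n) := by
  have h1 : component R Λ (m + n) (a * b) = a * b := by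
    show ((coact R Λ (a * b)).coeff (m + n)).snd = _
    rw [map_mul, coact_of_mem ha, coact_of_mem hb, place_mul, snd_coeff_place, if_pos rfl]
  obtain ⟨c, hc, e⟩ := exists_homogeneous_sum hfin (a * b)
  rw [← h1, ← e, component_sum hc]
  exact hc _

theorem component_mul_left (hfin : Λ.RowFinite) {m : Fin k → ℤ} {b : KP R Λ}
    (hb : b ∈ homogeneous R Λ m) (a : KP R Λ) (n : Fin k → ℤ) :
    component R Λ n (b * a) = b * component R Λ (n - m) a := by
  obtain ⟨c, hc, rfl⟩ := exists_homogeneous_sum hfin a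
  rw [component_sum hc, Finsupp.sum, Finset.mul_sum, map_sum]
  rw [Finset.sum_congr rfl fun i _ => component_of_mem (mul_mem_homogeneous hfin hb (hc i)) n]
  simp only [← eq_sub_iff_add_eq', Finset.sum_ite_eq']
  split_ifs with h
  · rfl
  · rw [Finsupp.notMem_support_iff.1 h, mul_zero]

theorem component_mul_right (hfin : Λ.RowFinite) {m : Fin k → ℤ} {b : KP R Λ}
    (hb : b ∈ homogeneous R Λ m) (a : KP R Λ) (n : Fin k → ℤ) :
    component R Λ n (a * b) = component R Λ (n - m) a * b := by
  obtain ⟨c, hc, rfl⟩ := exists_homogeneous_sum hfin a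
  rw [component_sum hc, Finsupp.sum, Finset.sum_mul, map_sum]
  rw [Finset.sum_congr rfl fun i _ => component_of_mem (mul_mem_homogeneous hfin (hc i) hb) n]
  simp only [← eq_sub_iff_add_eq, Finset.sum_ite_eq']
  split_ifs with h
  · rfl
  · rw [Finsupp.notMem_support_iff.1 h, zero_mul]

theorem sum_mem_ideal (I : TwoSidedIdeal (KP R Λ)) {ι : Type*} {t : Finset ι} {f : ι → KP R Λ}
    (h : ∀ i ∈ t, f i ∈ I) : ∑ i ∈ t, f i ∈ I :=
  Finset.sum_induction f (· ∈ I) (fun _ _ => I.add_mem) I.zero_mem h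

/-- The elements all of whose homogeneous components lie in `I`. -/
noncomputable def homogeneousCore (hfin : Λ.RowFinite) (I : TwoSidedIdeal (KP R Λ)) :
    TwoSidedIdeal (KP R Λ) :=
  TwoSidedIdeal.mk' {a | ∀ n, component R Λ n a ∈ I}
    (fun n => by rw [map_zero]; exact I.zero_mem)
    (fun ha hb n => by rw [map_add]; exact I.add_mem (ha n) (hb n))
    (fun ha n => by rw [map_neg]; exact I.neg_mem (ha n))
    (fun {b a} ha n => by
      obtain ⟨c, hc, rfl⟩ := exists_homogeneous_sum hfin b
      rw [Finsupp.sum, Finset.sum_mul, map_sum]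
      refine sum_mem_ideal I fun i _ => ?_
      rw [component_mul_left hfin (hc i)]
      exact I.mul_mem_left _ _ (ha _))
    (fun {a b} ha n => by
      obtain ⟨c, hc, rfl⟩ := exists_homogeneous_sum hfin b
      rw [Finsupp.sum, Finset.mul_sum, map_sum]
      refine sum_mem_ideal I fun i _ => ?_
      rw [component_mul_right hfin (hc i)]
      exact I.mul_mem_right _ _ (ha _))

theorem mem_homogeneousCore (hfin : Λ.RowFinite) {I : TwoSidedIdeal (KP R Λ)} {a : KP R Λ} :
    a ∈ homogeneousCore hfin I ↔ ∀ n, component R Λ n a ∈ I :=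
  TwoSidedIdeal.mem_mk' ..

/-- An ideal generated by homogeneous elements is graded. -/
theorem isGraded_span (hfin : Λ.RowFinite) {S : Set (KP R Λ)}
    (hS : ∀ a ∈ S, ∃ n, a ∈ homogeneous R Λ n) : IsGraded (TwoSidedIdeal.span S) := by
  refine ⟨fun m n a b _ ha _ hb => mul_mem_homogeneous hfin ha hb, fun a ha => ?_⟩
  -- The core is an ideal and contains the generators, each of which has a single nonzero component
  -- at most; hence it contains the whole span.
  have hle : TwoSidedIdeal.span S ≤ homogeneousCore hfin (TwoSidedIdeal.span S) := by
    refine TwoSidedIdeal.span_le.2 fun b hb => (mem_homogeneousCore hfin).2 fun n => ?_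
    obtain ⟨m, hm⟩ := hS b hb
    rw [component_of_mem hm]
    split_ifs
    · exact TwoSidedIdeal.subset_span hb
    · exact TwoSidedIdeal.zero_mem _
  obtain ⟨c, hc, e⟩ := exists_homogeneous_sum hfin a
  refine ⟨c, ⟨fun n => ⟨?_, hc n⟩, e⟩, fun c' hc' => ?_⟩
  · rw [← component_sum hc, e]
    exact (mem_homogeneousCore hfin).1 (hle ha) n
  · ext n
    rw [← component_sum hc, e, ← hc'.2, component_sum fun n => (hc'.1 n).2]

theorem IsGraded.component_mem {I : TwoSidedIdeal (KP R Λ)} (hI : IsGraded I) {a : KP R Λ}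
    (ha : a ∈ I) (n : Fin k → ℤ) : component R Λ n a ∈ I := by
  obtain ⟨c, ⟨hc, rfl⟩, -⟩ := hI.2 a ha
  rw [component_sum fun n => (hc n).2]
  exact (hc n).1

end KP

/-! ### Aperiodicity of `Λ ∖ H` and periods of infinite paths -/

namespace KGraph

variable {k : ℕ} {Λ : KGraph.{u, v} k}

/-- The outer factors avoid `H` automatically: the last one has the source of `l`, and the first one
has a source outside `H` by heredity along `μ`. -/
theorem isSegment_removeHereditary_iff {H : Set Λ.Vert} {hH : Λ.Hereditary H}
    {l μ : (Λ.removeHereditary H hH).Path} {p q : Fin k → ℕ} :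
    (Λ.removeHereditary H hH).IsSegment l p q μ ↔ Λ.IsSegment l.1 p q μ.1 := by
  constructor
  · rintro ⟨α, β, h₁, h₂, hα, hμ, e⟩
    exact ⟨α.1, β.1, congrArg Subtype.val h₁, congrArg Subtype.val h₂, hα, hμ,
      congrArg Subtype.val e⟩
  · rintro ⟨α, β, h₁, h₂, hα, hμ, e⟩
    have hβ : Λ.src β ∉ H := by
      have := l.2
      rwa [← e, Λ.src_comp] at this
    have hα' : Λ.src α ∉ H := fun h => μ.2 (hH μ.1 (h₁ ▸ h))
    exact ⟨⟨α, hα'⟩, ⟨β, hβ⟩, Subtype.ext h₁, Subtype.ext h₂, hα, hμ, Subtype.ext e⟩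

theorem IsSegment.src_notMem {H : Set Λ.Vert} (hH : Λ.Hereditary H) {l μ : Λ.Path}
    {p q : Fin k → ℕ} (h : Λ.IsSegment l p q μ) (hl : Λ.src l ∉ H) : Λ.src μ ∉ H := by
  obtain ⟨α, β, h₁, h₂, -, -, rfl⟩ := h
  intro hμ
  rw [Λ.src_comp] at h₂ hl
  exact hl (hH β (h₂ ▸ hμ))

namespace InfPath

variable {H : Set Λ.Vert}

theorem isSegment_seg (x : Λ.InfPath H) {p q n : Fin k → ℕ} (h : p + q ≤ n) :
    Λ.IsSegment (x.seg n) p (p + q) ((x.shift p).seg q) := by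
  have h' : p + q ≤ Λ.deg (x.seg n) := by rwa [x.deg_seg]
  rw [isSegment_iff h', ← suf_pre h', x.pre_seg h]
  rfl

/-- Failure of aperiodicity forces a common period of all infinite paths at some vertex. -/
theorem exists_period_of_not_aperiodic {hH : Λ.Hereditary H}
    (h : ¬ (Λ.removeHereditary H hH).Aperiodic) :
    ∃ w ∉ H, ∃ m n : Fin k → ℕ, m ≠ n ∧
      ∀ x : Λ.InfPath H, x.rng = w → x.shift m = x.shift n := by
  rw [Aperiodic] at h
  push Not at h
  obtain ⟨w, m, n, hmn, h⟩ := h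
  refine ⟨w.1, w.2, m, n, hmn, fun x hx => ?_⟩
  ext q
  -- The failure of aperiodicity is applied to `x(0, m ⊔ n + q)`, for which the compared segments
  -- are the initial segments of degree `q` of the two shifts.
  have hs := x.src_seg (m ⊔ n + q)
  have hsub : Λ.deg (x.seg (m ⊔ n + q)) - (m ⊔ n) = q := by
    rw [x.deg_seg, add_tsub_cancel_left]
  have hm := x.isSegment_seg (p := m) (q := q) (n := m ⊔ n + q) (by gcongr; exact le_sup_left)
  have hn := x.isSegment_seg (p := n) (q := q) (n := m ⊔ n + q) (by gcongr; exact le_sup_right)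
  have hm' : Λ.IsSegment (x.seg (m ⊔ n + q)) m
      (m + (Λ.deg (x.seg (m ⊔ n + q)) - (m ⊔ n))) ((x.shift m).seg q) := by rwa [hsub]
  have hn' : Λ.IsSegment (x.seg (m ⊔ n + q)) n
      (n + (Λ.deg (x.seg (m ⊔ n + q)) - (m ⊔ n))) ((x.shift n).seg q) := by rwa [hsub]
  have key := h ⟨x.seg (m ⊔ n + q), hs⟩ (Subtype.ext ((x.rng_seg _).trans hx))
    (by show m ⊔ n ≤ Λ.deg _; rw [x.deg_seg]; exact le_self_add)
    ⟨_, hm.src_notMem hH hs⟩ ⟨_, hn.src_notMem hH hs⟩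
    (isSegment_removeHereditary_iff.2 hm')
    (isSegment_removeHereditary_iff.2 hn')
  exact congrArg Subtype.val key

end InfPath

end KGraph

namespace KP

open KGraph

variable {k : ℕ} {R : Type w} [CommRing R] {Λ : KGraph.{u, v} k}

/-! ### The representation on functions on infinite paths -/

section Representation

variable (R) {H : Set Λ.Vert}

open Classical in
/-- The action of `p_v`. -/
noncomputable def repVert (v : Λ.Vert) : Module.End R (Λ.InfPath H → R) where
  toFun f y := if y.rng = v then f y else 0
  map_add' f g := by ext y; simp only [Pi.add_apply]; split_ifs <;> simp
  map_smul' r f := by ext y; simp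

open Classical in
/-- The action of `s_l`. -/
noncomputable def repPath (l : Λ.Path) : Module.End R (Λ.InfPath H → R) where
  toFun f y := if y.seg (Λ.deg l) = l then f (y.shift (Λ.deg l)) else 0
  map_add' f g := by ext y; simp only [Pi.add_apply]; split_ifs <;> simp
  map_smul' r f := by ext y; simp

open Classical in
/-- The action of `s_{l*}`. -/
noncomputable def repGhost (hH : Λ.Hereditary H) (l : Λ.Path) :
    Module.End R (Λ.InfPath H → R) where
  toFun f x := if h : Λ.src l = x.rng then f (x.cat hH l h) else 0
  map_add' f g := by ext y; simp only [Pi.add_apply]; split_ifs <;> simp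
  map_smul' r f := by ext y; simp

open Classical in
theorem repVert_apply (v : Λ.Vert) (f : Λ.InfPath H → R) (y : Λ.InfPath H) :
    repVert R v f y = if y.rng = v then f y else 0 := rfl

open Classical in
theorem repPath_apply (l : Λ.Path) (f : Λ.InfPath H → R) (y : Λ.InfPath H) :
    repPath R l f y = if y.seg (Λ.deg l) = l then f (y.shift (Λ.deg l)) else 0 := rfl

open Classical in
theorem repGhost_apply (hH : Λ.Hereditary H) (l : Λ.Path) (f : Λ.InfPath H → R)
    (x : Λ.InfPath H) :
    repGhost R hH l f x = if h : Λ.src l = x.rng then f (x.cat hH l h) else 0 := rfl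

/-- The action of the letters. -/
noncomputable def repLetter (hH : Λ.Hereditary H) : Λ.Gen → Module.End R (Λ.InfPath H → R)
  | .vert v => repVert R v
  | .path l => repPath R l.1
  | .ghost l => repGhost R hH l.1

theorem rng_of_seg_eq {y : Λ.InfPath H} {n : Fin k → ℕ} {l : Λ.Path} (h : y.seg n = l) :
    y.rng = Λ.rng l := by rw [← h, y.rng_seg]

theorem lift_repLetter (hH : Λ.Hereditary H) (a : KPFree R Λ) (ha : KPFree.Relator R a) :
    KPFree.lift (repLetter R hH) a = 0 := by
  classical
  cases ha with
  | vert_idem x =>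
    simp only [map_sub, map_mul, KPFree.lift_letter, repLetter, sub_eq_zero]
    ext f y
    simp only [Module.End.mul_apply, repVert_apply]
    split_ifs <;> rfl
  | vert_orth x x' h =>
    simp only [map_mul, KPFree.lift_letter, repLetter]
    ext f y
    simp only [Module.End.mul_apply, repVert_apply]
    split_ifs with h1 h2
    · exact absurd (h1.symm.trans h2) h
    · rfl
    · rfl
  | path_comp l μ ν h hl =>
    simp only [map_sub, map_mul, KPFree.lift_letter, repLetter, sub_eq_zero]
    ext f y
    simp only [Module.End.mul_apply, repPath_apply, hl]
    by_cases hy : y.seg (Λ.deg (Λ.comp μ.1 ν.1 h)) = Λ.comp μ.1 ν.1 h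
    · obtain ⟨h1, h2⟩ := (y.seg_add_eq_comp_iff _ _ h).1 hy
      rw [if_pos hy, if_pos h1, if_pos h2, InfPath.shift_shift, Λ.deg_comp]
    · rw [if_neg hy]
      split_ifs with h1 h2
      · exact absurd ((y.seg_add_eq_comp_iff _ _ h).2 ⟨h1, h2⟩) hy
      · rfl
      · rfl
  | ghost_comp l μ ν h hl =>
    simp only [map_sub, map_mul, KPFree.lift_letter, repLetter, sub_eq_zero]
    ext f x
    simp only [Module.End.mul_apply, repGhost_apply, hl]
    by_cases h1 : Λ.src ν.1 = x.rng
    · rw [dif_pos ((Λ.src_comp _ _ _).trans h1), dif_pos h1,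
        dif_pos (by rw [InfPath.rng_cat, h]), InfPath.cat_comp]
    · rw [dif_neg fun e => h1 ((Λ.src_comp _ _ _).symm.trans e), dif_neg h1]
  | rng_path l =>
    simp only [map_sub, map_mul, KPFree.lift_letter, repLetter, sub_eq_zero]
    ext f y
    simp only [Module.End.mul_apply, repPath_apply, repVert_apply]
    split_ifs with h1 h2 h3
    · rfl
    · rfl
    · exact absurd (rng_of_seg_eq h3) h1
    · rfl
  | path_src l =>
    simp only [map_sub, map_mul, KPFree.lift_letter, repLetter, sub_eq_zero]
    ext f y
    simp only [Module.End.mul_apply, repPath_apply, repVert_apply]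
    split_ifs with h1 h2
    · rfl
    · exact absurd (by rw [InfPath.rng_shift, h1]) h2
    · rfl
  | src_ghost l =>
    simp only [map_sub, map_mul, KPFree.lift_letter, repLetter, sub_eq_zero]
    ext f x
    simp only [Module.End.mul_apply, repGhost_apply, repVert_apply]
    split_ifs with h1 h2 h3
    · rfl
    · exact absurd h1.symm h2
    · exact absurd h3.symm h1
    · rfl
  | ghost_rng l =>
    simp only [map_sub, map_mul, KPFree.lift_letter, repLetter, sub_eq_zero]
    ext f x
    simp only [Module.End.mul_apply, repGhost_apply, repVert_apply, InfPath.rng_cat, if_true]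
  | ghost_path_self l =>
    simp only [map_sub, map_mul, KPFree.lift_letter, repLetter, sub_eq_zero]
    ext f x
    simp only [Module.End.mul_apply, repGhost_apply, repVert_apply, repPath_apply,
      InfPath.seg_cat_deg, InfPath.shift_cat, if_true, dite_eq_ite]
    exact if_congr eq_comm rfl rfl
  | ghost_path_ne l μ hd h =>
    simp only [map_mul, KPFree.lift_letter, repLetter]
    ext f x
    simp only [Module.End.mul_apply, repGhost_apply, repPath_apply]
    split_ifs with h1 h2
    · have := InfPath.seg_cat_deg hH l.1 x h1
      rw [hd] at this
      exact absurd (Subtype.ext (this.symm.trans h2)) h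
    · rfl
    · rfl
  | sum_path_ghost x n hn t ht =>
    simp only [map_sub, map_sum, map_mul, KPFree.lift_letter, repLetter, sub_eq_zero]
    ext f y
    -- `s_l s_{l*}` acts as multiplication by the indicator of the infinite paths that begin with
    -- `l`. A path `y` with range `x` meets exactly one of these cylinders, that of `y.seg n`.
    have hterm : ∀ l ∈ t, (repPath R l.1 * repGhost R hH l.1 :
        Module.End R (Λ.InfPath H → R)) f y =
        if y.seg n = l.1 then f y else 0 := by
      intro l hl
      rw [Module.End.mul_apply, repPath_apply, ((ht l).1 hl).2]
      split_ifs with h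
      · rw [repGhost_apply, dif_pos (by rw [InfPath.rng_shift, h])]
        congr 1
        simp only [← h, InfPath.cat_shift]
      · rfl
    rw [LinearMap.sum_apply, Finset.sum_apply, Finset.sum_congr rfl hterm, repVert_apply]
    have hpos : Λ.deg (y.seg n) ≠ 0 := by rwa [y.deg_seg]
    split_ifs with h
    · rw [Finset.sum_eq_single ⟨y.seg n, hpos⟩, if_pos rfl]
      · exact fun l _ hne => if_neg fun e => hne (Subtype.ext e.symm)
      · exact fun hmem => absurd ((ht _).2 ⟨(y.rng_seg n).trans h, y.deg_seg n⟩) hmem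
    · refine (Finset.sum_eq_zero fun l hl => if_neg fun e => h ?_).symm
      rw [rng_of_seg_eq e, ((ht l).1 hl).1]

/-- The representation of the Kumjian–Pask algebra on the functions on the infinite paths whose
vertices lie outside a hereditary set `H`. -/
noncomputable def rep (hH : Λ.Hereditary H) : KP R Λ →ₙₐ[R] Module.End R (Λ.InfPath H → R) :=
  lift (repLetter R hH) (lift_repLetter R hH)

variable (hH : Λ.Hereditary H)

theorem rep_p (v : Λ.Vert) : rep R hH (p R v) = repVert R v := lift_mk_letter _ _ _

theorem rep_s (l : Λ.Path) : rep R hH (s R l) = repPath R l := by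
  by_cases h : Λ.deg l = 0
  · rw [s_of_deg_eq_zero h, rep_p]
    ext f y
    have h0 : y.shift 0 = y := by
      ext n
      show suf (y.seg (0 + n)) 0 = _
      rw [suf_zero, zero_add]
    rw [repVert_apply, repPath_apply, h, h0]
    congr 1
    refine propext ⟨fun hy => ?_, rng_of_seg_eq⟩
    rw [eq_id_of_deg_eq_zero (y.deg_seg 0), y.rng_seg, hy, ← eq_id_of_deg_eq_zero h]
  · rw [s_of_deg_ne_zero h]
    exact lift_mk_letter _ _ _

theorem rng_notMem (x : Λ.InfPath H) : x.rng ∉ H := by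
  rw [← x.rng_seg 0, ← src_eq_rng_of_deg_eq_zero (x.deg_seg 0)]
  exact x.src_seg 0

theorem rep_p_eq_zero {v : Λ.Vert} (hv : v ∈ H) : rep R hH (p R v) = 0 := by
  rw [rep_p]
  ext f y
  exact if_neg fun h => rng_notMem y (by rwa [h])

variable {R}

/-- If `v ∉ H`, some infinite path outside `H` starts at `v`; evaluating the image of the constant
function `1` there gives `r`. -/
theorem mem_of_rep_smul_p_eq_zero (hs : Λ.Saturated H) {r : R} (hr : r ≠ 0) {v : Λ.Vert}
    (h : rep R hH (r • p R v) = 0) : v ∈ H := by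
  by_contra hv
  obtain ⟨x, hx⟩ := InfPath.exists_rng_eq hH hs hv
  rw [map_smul, rep_p] at h
  have := congrFun (LinearMap.congr_fun h fun _ => 1) x
  rw [LinearMap.smul_apply, Pi.smul_apply, repVert_apply, if_pos hx, smul_eq_mul, mul_one] at this
  exact hr this

theorem isBasic_ker_rep (hs : Λ.Saturated H) : IsBasic (TwoSidedIdeal.ker (rep R hH)) := by
  intro r x hr h
  rw [TwoSidedIdeal.mem_ker] at h ⊢
  exact rep_p_eq_zero R hH (mem_of_rep_smul_p_eq_zero hH hs hr h)

end Representation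

theorem vertexIdeal_le_ker_rep (H : Λ.SatHer) :
    vertexIdeal R H ≤ TwoSidedIdeal.ker (rep R H.hereditary) := by
  refine TwoSidedIdeal.span_le.2 ?_
  rintro _ ⟨v, hv, rfl⟩
  exact (TwoSidedIdeal.mem_ker _).2 (rep_p_eq_zero R _ hv)

theorem p_mem_vertexIdeal {H : Λ.SatHer} {v : Λ.Vert} (hv : v ∈ H.carrier) :
    p R v ∈ vertexIdeal R H :=
  TwoSidedIdeal.subset_span ⟨v, hv, rfl⟩

/-- Since `rep` kills `I_H`, it detects the vertices outside `H`. This yields both the basicness of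
`I_H` and the recovery of `H` from `I_H`. -/
theorem mem_of_smul_p_mem_vertexIdeal {H : Λ.SatHer} {r : R} (hr : r ≠ 0) {v : Λ.Vert}
    (h : r • p R v ∈ vertexIdeal R H) : v ∈ H.carrier :=
  mem_of_rep_smul_p_eq_zero H.hereditary H.saturated hr
    ((TwoSidedIdeal.mem_ker _).1 (vertexIdeal_le_ker_rep H h))

theorem isBasic_vertexIdeal (H : Λ.SatHer) : IsBasic (vertexIdeal R H) :=
  fun _ _ hr h => p_mem_vertexIdeal (mem_of_smul_p_mem_vertexIdeal hr h)

theorem p_mem_vertexIdeal_iff [Nontrivial R] {H : Λ.SatHer} {v : Λ.Vert} :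
    p R v ∈ vertexIdeal R H ↔ v ∈ H.carrier :=
  ⟨fun h => mem_of_smul_p_mem_vertexIdeal (one_ne_zero (α := R)) (by rwa [one_smul]),
    p_mem_vertexIdeal⟩

/-- A common period at a vertex outside `H` yields two paths of different degrees with the same
image under the representation. -/
theorem exists_rep_s_eq {H : Λ.SatHer} (h : ¬ (Λ.remove H).Aperiodic) :
    ∃ κ l : Λ.Path, Λ.deg κ ≠ Λ.deg l ∧ Λ.src l ∉ H.carrier ∧
      rep R H.hereditary (s R κ) = rep R H.hereditary (s R l) := by
  obtain ⟨w, hw, m, n, hmn, hper⟩ := InfPath.exists_period_of_not_aperiodic h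
  obtain ⟨x, hx⟩ := InfPath.exists_rng_eq H.hereditary H.saturated hw
  -- With `m + d = m ⊔ n`, an initial segment of degree `m + d` determines the one of degree `n`.
  obtain ⟨d, hd⟩ := exists_add_of_le (le_sup_left : m ≤ m ⊔ n)
  have hn : n ≤ m + d := hd ▸ le_sup_right
  have hper' : ∀ y : Λ.InfPath H.carrier, y.rng = w → y.shift (n + d) = y.shift (m + d) :=
    fun y hy => by rw [← y.shift_shift, ← y.shift_shift, hper y hy]
  -- `y(0, n)` is part of `y(0, m + d)`, and the period identifies `y(n, n + d)` with `y(m, m + d)`.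
  have hfwd : ∀ y : Λ.InfPath H.carrier, y.seg (m + d) = x.seg (m + d) →
      y.seg (n + d) = x.seg (n + d) := by
    intro y hy
    have hyw : y.rng = w := by rw [rng_of_seg_eq hy, x.rng_seg, hx]
    have h1 : y.seg n = x.seg n := by rw [← y.pre_seg hn, hy, x.pre_seg hn]
    have h2 : (y.shift n).seg d = (x.shift n).seg d := by
      rw [← hper y hyw, ← hper x hx]
      exact congrArg (suf · m) hy
    obtain ⟨g, e⟩ := y.comp_seg_shift n d
    obtain ⟨g', e'⟩ := x.comp_seg_shift n d
    rw [← e, ← e']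
    exact comp_congr h1 h2 g
  have hsrc : Λ.src (x.seg (n + d)) = Λ.src (x.seg (m + d)) := by
    rw [← x.rng_shift, hper' x hx, x.rng_shift]
  -- The previous argument does not reverse, since `m ≤ n + d` may fail. Instead `y` is compared
  -- with `z`, obtained by putting `x(0, m + d)` in front of the shift of `y` by `n + d`. By `hfwd`
  -- and the period, `z` and `y` have the same initial segment of degree `n + d` and the same
  -- remainder, so `z = y`.
  have hbwd : ∀ y : Λ.InfPath H.carrier, y.seg (n + d) = x.seg (n + d) →
      y.seg (m + d) = x.seg (m + d) := by
    intro y hy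
    have hz : Λ.src (x.seg (m + d)) = (y.shift (n + d)).rng := by
      rw [y.rng_shift, hy, hsrc]
    set z := (y.shift (n + d)).cat H.hereditary (x.seg (m + d)) hz with hzdef
    have hz1 : z.seg (m + d) = x.seg (m + d) := by
      have := InfPath.seg_cat_deg H.hereditary (x.seg (m + d)) (y.shift (n + d)) hz
      rwa [x.deg_seg] at this
    have hz2 : z.shift (m + d) = y.shift (n + d) := by
      have := InfPath.shift_cat H.hereditary (x.seg (m + d)) (y.shift (n + d)) hz
      rwa [x.deg_seg] at this
    have hzw : z.rng = w := by rw [rng_of_seg_eq hz1, x.rng_seg, hx]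
    have hzy : z = y := by
      refine InfPath.ext_add (n + d) fun q => ?_
      obtain ⟨g, e⟩ := z.comp_seg_shift (n + d) q
      obtain ⟨g', e'⟩ := y.comp_seg_shift (n + d) q
      rw [← e, ← e']
      refine comp_congr ((hfwd z hz1).trans hy.symm) ?_ g
      rw [hper' z hzw, hz2]
    rw [← hzy, hz1]
  refine ⟨x.seg (n + d), x.seg (m + d), ?_, x.src_seg _, ?_⟩
  · rw [x.deg_seg, x.deg_seg]
    exact fun e => hmn (add_right_cancel e).symm
  · rw [rep_s, rep_s]
    ext f y
    rw [repPath_apply, repPath_apply, x.deg_seg, x.deg_seg]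
    by_cases hy : y.seg (n + d) = x.seg (n + d)
    · rw [if_pos hy, if_pos (hbwd y hy), hper' y]
      rw [rng_of_seg_eq hy, x.rng_seg, hx]
    · rw [if_neg hy, if_neg (mt (hfwd y) hy)]

end KP

namespace KP

open KGraph

variable {k : ℕ} {R : Type w} [CommRing R] {Λ : KGraph.{u, v} k}

/-! ### Basic ideals and saturated hereditary sets -/

/-- The vertices whose idempotents lie in an ideal form a saturated hereditary set. -/
def vertexSet (hfin : Λ.RowFinite) (I : TwoSidedIdeal (KP R Λ)) : Λ.SatHer where
  carrier := {x | p R x ∈ I}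
  hereditary l (hl : p R (Λ.rng l) ∈ I) := by
    show p R (Λ.src l) ∈ I
    rw [← sStar_mul_s_self, ← p_mul_s l]
    exact I.mul_mem_left _ _ (I.mul_mem_right _ _ hl)
  saturated x n h := by
    show p R x ∈ I
    rw [p_eq_sum hfin x n]
    refine sum_mem_ideal I fun l hl => ?_
    rw [mem_paths] at hl
    rw [← s_mul_p]
    exact I.mul_mem_right _ _ (I.mul_mem_left _ _ (h l hl.1 hl.2))

theorem vertexIdeal_vertexSet_le (hfin : Λ.RowFinite) (I : TwoSidedIdeal (KP R Λ)) :
    vertexIdeal R (vertexSet hfin I) ≤ I := by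
  refine TwoSidedIdeal.span_le.2 ?_
  rintro _ ⟨x, hx, rfl⟩
  exact hx

/-- For equal degrees `s_{α*} s_β` already vanishes. Otherwise aperiodicity gives an `l` such that
`αl` and `βl` differ in segments of equal degree starting at the common position `deg α + deg β`. -/
theorem exists_separating_path {H : Λ.SatHer} (hap : (Λ.remove H).Aperiodic) {α β : Λ.Path}
    (hs : Λ.src α = Λ.src β) (hα : Λ.src α ∉ H.carrier) (hne : α ≠ β) :
    ∃ l : Λ.Path, Λ.rng l = Λ.src α ∧ Λ.src l ∉ H.carrier ∧
      sStar R l * (sStar R α * s R β) * s R l = 0 := by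
  by_cases hd : Λ.deg α = Λ.deg β
  · refine ⟨Λ.id (Λ.src α), Λ.rng_id _, by rwa [Λ.src_id], ?_⟩
    rw [sStar_mul_s_of_ne hd hne, mul_zero, zero_mul]
  -- The degrees are exchanged on purpose: `α` is followed by an initial piece of `l` of degree `deg
  -- β`, and `β` by one of degree `deg α`.
  obtain ⟨⟨l, hl⟩, hr, hle, ⟨μ, hμ⟩, ⟨ν, hν⟩, h1, h2, hμν⟩ :=
    hap ⟨Λ.src α, hα⟩ (Λ.deg β) (Λ.deg α) (Ne.symm hd)
  obtain ⟨a, b, e1, e2, ha, hμd, hl1⟩ := isSegment_removeHereditary_iff.1 h1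
  obtain ⟨a', b', e1', e2', ha', hνd, hl2⟩ := isSegment_removeHereditary_iff.1 h2
  dsimp only at e1 e2 ha hμd hl1 e1' e2' ha' hνd hl2
  have hr' : Λ.rng l = Λ.src α := congrArg Subtype.val hr
  have hdeg : Λ.deg μ = Λ.deg ν := (add_left_cancel hμd).trans (add_left_cancel hνd).symm
  have hμν' : μ ≠ ν := fun h => hμν (Subtype.ext h)
  refine ⟨l, hr', hl, ?_⟩
  have hαa : Λ.src α = Λ.rng a := by rw [← hr', ← hl1, Λ.rng_comp, Λ.rng_comp]
  have hβa : Λ.src β = Λ.rng a' := by rw [← hs, ← hr', ← hl2, Λ.rng_comp, Λ.rng_comp]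
  have hL : sStar R l * sStar R α = sStar R b * (sStar R μ * sStar R (Λ.comp α a hαa)) := by
    rw [← hl1, sStar_comp, sStar_comp, sStar_comp, mul_assoc, mul_assoc]
  have hR : s R β * s R l = s R (Λ.comp β a' hβa) * s R ν * s R b' := by
    rw [← hl2, s_comp, s_comp, s_comp, mul_assoc, mul_assoc, mul_assoc]
  -- The extended paths have equal degree. If they differ, their product vanishes; if they agree,
  -- they cancel and leave `s_{μ*} s_ν = 0`.
  have hmid : sStar R μ * (sStar R (Λ.comp α a hαa) * s R (Λ.comp β a' hβa)) * s R ν = 0 := by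
    by_cases e : Λ.comp α a hαa = Λ.comp β a' hβa
    · rw [e, sStar_mul_s_self, Λ.src_comp, e1', mul_assoc, p_mul_s, sStar_mul_s_of_ne hdeg hμν']
    · rw [sStar_mul_s_of_ne _ e, mul_zero, zero_mul]
      rw [Λ.deg_comp, Λ.deg_comp, ha, ha', add_comm]
  calc sStar R l * (sStar R α * s R β) * s R l
      = (sStar R l * sStar R α) * (s R β * s R l) := by simp only [mul_assoc]
    _ = sStar R b * (sStar R μ * (sStar R (Λ.comp α a hαa) * s R (Λ.comp β a' hβa)) * s R ν) *
        s R b' := by rw [hL, hR]; simp only [mul_assoc]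
    _ = 0 := by rw [hmid, mul_zero, zero_mul]

/-- The paths `β` are treated one at a time: `l` is extended by a path separating `αl` from `βl`,
and products that already vanish still vanish when compressed further. -/
theorem exists_separating_path_finset {H : Λ.SatHer} (hap : (Λ.remove H).Aperiodic)
    {α : Λ.Path} (hα : Λ.src α ∉ H.carrier) (G : Finset Λ.Path)
    (hG : ∀ β ∈ G, Λ.src α = Λ.src β ∧ α ≠ β) :
    ∃ l : Λ.Path, Λ.rng l = Λ.src α ∧ Λ.src l ∉ H.carrier ∧
      ∀ β ∈ G, sStar R l * (sStar R α * s R β) * s R l = 0 := by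
  classical
  induction G using Finset.induction_on with
  | empty => exact ⟨Λ.id (Λ.src α), Λ.rng_id _, by rwa [Λ.src_id], by simp⟩
  | insert β G hβ ih =>
    obtain ⟨l, hl, hlH, hlG⟩ := ih fun γ hγ => hG γ (Finset.mem_insert_of_mem hγ)
    obtain ⟨hs, hne⟩ := hG β (Finset.mem_insert_self _ _)
    have hne' : Λ.comp α l hl.symm ≠ Λ.comp β l (hs.symm.trans hl.symm) := fun e => by
      have hd := congrArg Λ.deg e
      rw [Λ.deg_comp, Λ.deg_comp] at hd
      exact hne (comp_inj (add_right_cancel hd) e).1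
    obtain ⟨μ, hμ, hμH, hz⟩ := exists_separating_path (R := R) hap
      (by rw [Λ.src_comp, Λ.src_comp]) (by rwa [Λ.src_comp]) hne'
    rw [Λ.src_comp] at hμ
    have hassoc : ∀ γ, sStar R (Λ.comp l μ hμ.symm) * (sStar R α * s R γ) *
        s R (Λ.comp l μ hμ.symm) =
        sStar R μ * (sStar R l * (sStar R α * s R γ) * s R l) * s R μ := fun γ => by
      rw [s_comp, sStar_comp]; simp only [mul_assoc]
    refine ⟨Λ.comp l μ hμ.symm, by rw [Λ.rng_comp, hl], by rwa [Λ.src_comp], fun γ hγ => ?_⟩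
    rw [hassoc]
    obtain rfl | hγ := Finset.mem_insert.1 hγ
    · rw [s_comp, sStar_comp] at hz
      simp only [mul_assoc] at hz ⊢
      exact hz
    · rw [hlG γ hγ, mul_zero, zero_mul]

/-- The scalar is absorbed into `s_α`, so stability of the ideal under ring multiplication suffices.
-/
theorem smul_s_mul_sStar_mem {I : TwoSidedIdeal (KP R Λ)} {α β : Λ.Path}
    (h : p R (Λ.src α) ∈ I) (r : R) : r • (s R α * sStar R β) ∈ I := by
  rw [← s_mul_p, ← smul_mul_assoc, ← smul_mul_assoc]
  exact I.mul_mem_right _ _ (I.mul_mem_left _ _ h)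

/-- If `Λ ∖ H` is aperiodic for the set `H` of vertices of a basic ideal, then the ideal is
generated by its vertices. -/
theorem IsBasic.eq_vertexIdeal (hfin : Λ.RowFinite) {I : TwoSidedIdeal (KP R Λ)}
    (hI : IsBasic I) (hap : (Λ.remove (vertexSet hfin I)).Aperiodic) :
    vertexIdeal R (vertexSet hfin I) = I := by
  classical
  refine le_antisymm (vertexIdeal_vertexSet_le hfin I) fun a ha => ?_
  obtain ⟨N, c, hc, rfl⟩ := exists_normal_form hfin a
  refine sum_mem_ideal _ fun q hq => smul_s_mul_sStar_mem (p_mem_vertexIdeal ?_) _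
  by_contra hqH
  obtain ⟨l, hl, hlH, hlG⟩ := exists_separating_path_finset (R := R) hap hqH
    ((c.support.image Prod.fst).filter fun β => Λ.src q.1 = Λ.src β ∧ q.1 ≠ β)
    fun β hβ => (Finset.mem_filter.1 hβ).2
  refine hlH (hI (c q) (Λ.src l) (Finsupp.mem_support_iff.1 hq) ?_)
  -- Terms whose ghost path differs from `q.2` die because all ghost paths have the same degree.
  -- Those with the same ghost path have a different first path and are killed by the choice of `l`.
  have key : sStar R l * sStar R q.1 * (c.sum fun q r => r • (s R q.1 * sStar R q.2)) *
      (s R q.2 * s R l) = c q • p R (Λ.src l) := by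
    rw [Finsupp.sum, Finset.mul_sum, Finset.sum_mul, Finset.sum_eq_single q]
    · have h1 : sStar R l * sStar R q.1 * (s R q.1 * sStar R q.2) * (s R q.2 * s R l) =
          sStar R l * ((sStar R q.1 * s R q.1) * ((sStar R q.2 * s R q.2) * s R l)) := by
        simp only [mul_assoc]
      rw [mul_smul_comm, smul_mul_assoc, h1, sStar_mul_s_self, sStar_mul_s_self, ← (hc q hq).1,
        ← hl, p_mul_s, p_mul_s, sStar_mul_s_self]
    · intro t ht htq
      have h1 : sStar R l * sStar R q.1 * (s R t.1 * sStar R t.2) * (s R q.2 * s R l) =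
          sStar R l * (sStar R q.1 * (s R t.1 * ((sStar R t.2 * s R q.2) * s R l))) := by
        simp only [mul_assoc]
      rw [mul_smul_comm, smul_mul_assoc, h1]
      by_cases e : t.2 = q.2
      · have hsrc : Λ.src q.1 = Λ.src t.1 := by rw [(hc q hq).1, ← e, (hc t ht).1]
        have hne : q.1 ≠ t.1 := fun h => htq (Prod.ext h.symm e)
        have h2 := hlG t.1 (Finset.mem_filter.2
          ⟨Finset.mem_image_of_mem _ ht, hsrc, hne⟩)
        rw [e, sStar_mul_s_self, ← (hc q hq).1, ← hl, p_mul_s]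
        simp only [mul_assoc] at h2
        rw [h2, smul_zero]
      · rw [sStar_mul_s_of_ne ((hc t ht).2.trans (hc q hq).2.symm) e, zero_mul, mul_zero,
          mul_zero, mul_zero, smul_zero]
    · exact fun h => absurd hq h
  rw [← key]
  exact I.mul_mem_right _ _ (I.mul_mem_left _ _ ha)

theorem isGraded_vertexIdeal (hfin : Λ.RowFinite) (H : Λ.SatHer) :
    IsGraded (vertexIdeal R H) := by
  refine isGraded_span hfin ?_
  rintro _ ⟨x, -, rfl⟩
  exact ⟨0, p_mem_homogeneous x⟩

/-- If `Λ ∖ H` is not aperiodic, the kernel of the representation on the infinite paths outside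
`H` is a basic ideal that is not graded. -/
theorem not_isGraded_ker_rep [Nontrivial R] {H : Λ.SatHer} (h : ¬ (Λ.remove H).Aperiodic) :
    ¬ IsGraded (TwoSidedIdeal.ker (rep R H.hereditary)) := by
  intro hg
  obtain ⟨κ, l, hd, hl, he⟩ := exists_rep_s_eq (R := R) h
  have hmem : s R l - s R κ ∈ TwoSidedIdeal.ker (rep R H.hereditary) :=
    (TwoSidedIdeal.mem_ker _).2 (by rw [map_sub, he, sub_self])
  -- The degrees of `l` and `κ` differ, so this component of `s_l - s_κ` is `s_l` alone.
  have hs := hg.component_mem hmem (intDeg l)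
  rw [map_sub, component_of_mem (s_mem_homogeneous l), component_of_mem (s_mem_homogeneous κ),
    if_pos rfl, if_neg (mt intDeg_inj.1 hd), sub_zero] at hs
  have hp := TwoSidedIdeal.mul_mem_left _ (sStar R l) _ hs
  rw [sStar_mul_s_self, TwoSidedIdeal.mem_ker] at hp
  exact hl (mem_of_rep_smul_p_eq_zero H.hereditary H.saturated (one_ne_zero (α := R))
    (by rwa [one_smul]))

/-- The correspondence between saturated hereditary sets and basic ideals. -/
noncomputable def satHerOrderIso [Nontrivial R] (hfin : Λ.RowFinite)
    (hap : ∀ H : Λ.SatHer, (Λ.remove H).Aperiodic) : Λ.SatHer ≃o BasicIdeal R Λ where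
  toFun H := ⟨vertexIdeal R H, isBasic_vertexIdeal H⟩
  invFun I := vertexSet hfin I.ideal
  left_inv H := SatHer.ext (Set.ext fun _ => p_mem_vertexIdeal_iff)
  right_inv I := BasicIdeal.ext (I.basic.eq_vertexIdeal hfin (hap _))
  map_rel_iff' {H K} := by
    refine ⟨fun h x hx => p_mem_vertexIdeal_iff.1 (h (p_mem_vertexIdeal (R := R) hx)),
      fun h => TwoSidedIdeal.span_le.2 ?_⟩
    rintro _ ⟨x, hx, rfl⟩
    exact p_mem_vertexIdeal (h hx)

end KP

theorem theorem5p8 {k : ℕ} (hk : 0 < k) (Λ : KGraph.{u, v} k) (hfin : Λ.RowFinite)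
    (hsrc : Λ.NoSources) (R : Type w) [CommRing R] [Nontrivial R] :
    ((∀ I : TwoSidedIdeal (KP R Λ), KP.IsBasic I → KP.IsGraded I) ↔
      ∀ H : Λ.SatHer, (Λ.remove H).Aperiodic) ∧
    ((∀ H : Λ.SatHer, (Λ.remove H).Aperiodic) →
      ∃ e : Λ.SatHer ≃o KP.BasicIdeal R Λ, ∀ H, (e H).ideal = KP.vertexIdeal R H) := by
  refine ⟨⟨fun h H => ?_, fun hap I hI => ?_⟩, fun hap => ⟨KP.satHerOrderIso hfin hap, fun _ => rfl⟩⟩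
  · by_contra hH
    exact KP.not_isGraded_ker_rep hH (h _ (KP.isBasic_ker_rep H.hereditary H.saturated))
  · rw [← hI.eq_vertexIdeal hfin (hap _)]
    exact KP.isGraded_vertexIdeal hfin _
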